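/- Let $\delta\ge 0$ be an integer, $\delta\Delta_2=\operatorname{conv}\{(0,0),(\delta,0),(0,\delta)\}\subset\mathbb R^2$ and $A=\delta\Delta_2\cap\mathbb Z^2$. A function $\omega:A\to\mathbb R$ *induces* the subdivision of $\delta\Delta_2$ whose cells are the images, under the projection omitting the last coordinate, of the lower faces of $\operatorname{conv}\{(a,\omega(a)) : a\in A\}\subset\mathbb R^3$. The *honeycomb triangulation* of $\delta\Delta_2$ is the triangulation cut out by the lines $x=\ell$, $y=\ell$, $x+y=\ell$ with $\ell\in\mathbb Z$; equivalently, it is the image under $(z_1,z_2)\mapsto(z_1-z_2,z_2)$ of the triangulation of $\operatorname{conv}\{(0,0),(\delta,0),(\delta,\delta)\}$ cut out by the lines $z_1=\ell$, $z_2=\ell$, $z_1-z_2=\ell$ with $\ell\in\mathbb Z$. A function $\omega:A\to\mathbb R$ induces the honeycomb triangulation of $\delta\Delta_2$ if and only if, for all integers $i,j\ge 1$ with $i+j\le\delta$: 1. $\omega(i-1,j-1)+\omega(i,j)>\omega(i-1,j)+\omega(i,j-1)$, 2. $\omega(i-1,j)+\omega(i+1,j-1)>\omega(i,j-1)+\omega(i,j)$,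 and 3. $\omega(i,j-1)+\omega(i-1,j+1)>\omega(i-1,j)+\omega(i,j)$. This is an irredundant facet description of the secondary cone $C\subset\mathbb R^A$, that is, of the set of all $\omega$ that induce the honeycomb triangulation: if any single one of these inequalities is omitted, the solution set of the remaining ones is different from $C$; assigning to each inequality the set of points of the closure $\overline C$ at which it holds with equality is a bijection from the inequalities onto the facets of $\overline C$; and assigning to each inequality the segment joining the two points on its right-hand side is a bijection from the inequalities onto the interior edges of the honeycomb triangulation, i.e. its edges not contained in the boundary of $\delta\Delta_2$. -/

import Mathlib

namespace Honeycomb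

/-- The dilated standard triangle `δ Δ₂ = conv {(0,0), (δ,0), (0,δ)}`, by its three facets. -/
def triangle (δ : ℕ) : Set (ℝ × ℝ) :=
  {x | 0 ≤ x.1 ∧ 0 ≤ x.2 ∧ x.1 + x.2 ≤ δ}

/-- The lattice points of `δ Δ₂`. -/
abbrev LatticePoint (δ : ℕ) : Type :=
  {p : ℤ × ℤ // 0 ≤ p.1 ∧ 0 ≤ p.2 ∧ p.1 + p.2 ≤ δ}

/-- A lattice point of `δ Δ₂` as a point of the real plane. -/
def LatticePoint.toPlane {δ : ℕ} (a : LatticePoint δ) : ℝ × ℝ :=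
  ((a.1.1 : ℝ), (a.1.2 : ℝ))

/-! ### Regular subdivisions and the secondary cone -/

/-- The convex hull of the lifted points `(a, ω a)`. -/
def liftedPolytope {δ : ℕ} (ω : LatticePoint δ → ℝ) : Set ((ℝ × ℝ) × ℝ) :=
  convexHull ℝ (Set.range fun a : LatticePoint δ => (a.toPlane, ω a))

/-- The lower face of the lifted polytope on which the linear form `α x + β y + h`
(whose coefficient at the height `h` is positive) attains its minimum. -/
def lowerFace {δ : ℕ} (ω : LatticePoint δ → ℝ) (α β : ℝ) : Set ((ℝ × ℝ) × ℝ) :=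
  {z ∈ liftedPolytope ω | ∀ w ∈ liftedPolytope ω,
    α * z.1.1 + β * z.1.2 + z.2 ≤ α * w.1.1 + β * w.1.2 + w.2}

/-- The subdivision of `δ Δ₂` induced by `ω`: the set of all its nonempty cells, of every dimension,
which are the projections of the lower faces of the lifted polytope. -/
def inducedSubdivision {δ : ℕ} (ω : LatticePoint δ → ℝ) : Set (Set (ℝ × ℝ)) :=
  {σ | ∃ α β : ℝ, σ = Prod.fst '' lowerFace ω α β}

/-- The (open) secondary cone of a polyhedral complex `T` on the lattice points of `δ Δ₂`: the set
of all height functions that induce `T`. -/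
def secondaryCone (δ : ℕ) (T : Set (Set (ℝ × ℝ))) : Set (LatticePoint δ → ℝ) :=
  {ω | inducedSubdivision ω = T}

/-- `F` is a facet of the convex set `C`: a nonempty exposed face of codimension one in `C`. -/
def IsFacet {E : Type*} [AddCommGroup E] [Module ℝ E] [TopologicalSpace E] (C F : Set E) : Prop :=
  F.Nonempty ∧ IsExposed ℝ C F ∧
    Module.finrank ℝ (vectorSpan ℝ F) + 1 = Module.finrank ℝ (vectorSpan ℝ C)

/-! ### The honeycomb triangulation -/

/-- The dilated triangle `δ Δ₂' = conv {(0,0), (δ,0), (δ,δ)}`, by its three facets. -/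
def alcovedTriangle (δ : ℕ) : Set (ℝ × ℝ) :=
  {z | 0 ≤ z.2 ∧ z.2 ≤ z.1 ∧ z.1 ≤ δ}

/-- The smallest closed cell containing `z` of the affine Coxeter arrangement of type `A₂`, which
consists of the lines `z₁ = ℓ`, `z₂ = ℓ`, `z₁ - z₂ = ℓ` with `ℓ` an integer. -/
def alcovedCell (z : ℝ × ℝ) : Set (ℝ × ℝ) :=
  {w | (⌊z.1⌋ ≤ w.1 ∧ w.1 ≤ ⌈z.1⌉) ∧ (⌊z.2⌋ ≤ w.2 ∧ w.2 ≤ ⌈z.2⌉) ∧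
    (⌊z.1 - z.2⌋ ≤ w.1 - w.2 ∧ w.1 - w.2 ≤ ⌈z.1 - z.2⌉)}

/-- The alcoved triangulation of `δ Δ₂'` (all nonempty cells, of every dimension). -/
def alcovedTriangulation (δ : ℕ) : Set (Set (ℝ × ℝ)) :=
  {σ | ∃ z ∈ alcovedTriangle δ, σ = alcovedCell z}

/-- The unimodular map with matrix `(1, -1; 0, 1)`, which maps `δ Δ₂'` onto `δ Δ₂`. -/
def tau (z : ℝ × ℝ) : ℝ × ℝ := (z.1 - z.2, z.2)

/-- The honeycomb triangulation of `δ Δ₂` (all nonempty cells, of every dimension). -/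
def honeycomb (δ : ℕ) : Set (Set (ℝ × ℝ)) :=
  {σ | ∃ ρ ∈ alcovedTriangulation δ, σ = tau '' ρ}

/-- The interior edges of the honeycomb triangulation: the one-dimensional cells that do not lie in
the boundary of `δ Δ₂`. -/
def interiorEdges (δ : ℕ) : Set (Set (ℝ × ℝ)) :=
  {σ ∈ honeycomb δ | Module.finrank ℝ (vectorSpan ℝ σ) = 1 ∧ ¬ σ ⊆ frontier (triangle δ)}

/-! ### The three families of inequalities -/

/-- The labels of the inequalities: one of the three families together with integers
`i, j ≥ 1` such that `i + j ≤ δ`. -/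
inductive Label (δ : ℕ) : Type
  | first (i j : ℤ) (hi : 1 ≤ i) (hj : 1 ≤ j) (hij : i + j ≤ δ) : Label δ
  | second (i j : ℤ) (hi : 1 ≤ i) (hj : 1 ≤ j) (hij : i + j ≤ δ) : Label δ
  | third (i j : ℤ) (hi : 1 ≤ i) (hj : 1 ≤ j) (hij : i + j ≤ δ) : Label δ

/-- The two points on the larger side of an inequality. -/
def Label.large {δ : ℕ} : Label δ → LatticePoint δ × LatticePoint δ
  | .first i j _ _ _ => (⟨(i - 1, j - 1), by grind⟩, ⟨(i, j), by grind⟩)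
  | .second i j _ _ _ => (⟨(i - 1, j), by grind⟩, ⟨(i + 1, j - 1), by grind⟩)
  | .third i j _ _ _ => (⟨(i, j - 1), by grind⟩, ⟨(i - 1, j + 1), by grind⟩)

/-- The two points on the smaller side of an inequality. -/
def Label.small {δ : ℕ} : Label δ → LatticePoint δ × LatticePoint δ
  | .first i j _ _ _ => (⟨(i - 1, j), by grind⟩, ⟨(i, j - 1), by grind⟩)
  | .second i j _ _ _ => (⟨(i, j - 1), by grind⟩, ⟨(i, j), by grind⟩)
  | .third i j _ _ _ => (⟨(i - 1, j), by grind⟩, ⟨(i, j), by grind⟩)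

/-- Larger side minus smaller side; the inequality with label `e` reads `0 < e.form ω`. -/
def Label.form {δ : ℕ} (e : Label δ) (ω : LatticePoint δ → ℝ) : ℝ :=
  ω e.large.1 + ω e.large.2 - (ω e.small.1 + ω e.small.2)

/-- The segment joining the two points on the smaller side of an inequality. -/
def Label.edge {δ : ℕ} (e : Label δ) : Set (ℝ × ℝ) :=
  segment ℝ e.small.1.toPlane e.small.2.toPlane

/-- The part of the closed secondary cone of the honeycomb triangulation on which the inequality
with label `e` is an equality. -/
def Label.wall {δ : ℕ} (e : Label δ) : Set (LatticePoint δ → ℝ) :=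
  {ω ∈ closure (secondaryCone δ (honeycomb δ)) | e.form ω = 0}

end Honeycomb

namespace Honeycomb

variable {δ : ℕ}

/-! Each inequality compares the two diagonals of a unit rhombus, that is, it asks `ω` to be
strictly convex across the edge forming the shorter-valued diagonal. The theorem is a
local-to-global principle for this convexity. Sufficiency. A cell of the induced subdivision is the
hull of the minimizers of `ω` plus a linear form (`image_fst_lowerFace`). The inequalities make the
lattice differences in the three edge directions strictly monotone (`LocallyConvex.diff_fst_lt` and
its images under symmetry). Tilt `ω` so that it is constant on the vertices of a unit triangle: from
every other lattice point there is then a unit step that decreases the value, so the minimizers are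
exactly these vertices (`exposed_up`, `exposed_down`). Faces of exposed sets are exposed, so every
honeycomb cell occurs. No other cell occurs, because sets of minimizers whose hulls share a relative
interior point coincide (`minimizers_subset_of_weights`). Necessity. If an interior edge is a cell,
some tilt of `ω` is minimal exactly at its endpoints. The two diagonals of the rhombus have the same
midpoint, so the tilt does not change the difference of the two sides, which is therefore positive.
Facets. The closed secondary cone is polyhedral. A quadratic form gives every inequality the value
`1`, and a piecewise linear `fold` gives a chosen one the value `-1` and the others nonnegative
values. Their sum is a point on exactly one wall. This proves irredundancy and, through the general
`bijOn_polyhedralWall_facets`, the bijection with the facets. -/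

instance : Finite (LatticePoint δ) := by
  have h : Set.Finite {p : ℤ × ℤ | 0 ≤ p.1 ∧ 0 ≤ p.2 ∧ p.1 + p.2 ≤ δ} := by
    refine ((Set.finite_Icc (0 : ℤ) δ).prod (Set.finite_Icc (0 : ℤ) δ)).subset ?_
    rintro ⟨x, y⟩ ⟨h₁, h₂, h₃⟩
    simp only [Set.mem_prod, Set.mem_Icc] at *
    omega
  exact h.to_subtype

noncomputable instance : Fintype (LatticePoint δ) := Fintype.ofFinite _

instance : Nonempty (LatticePoint δ) := ⟨⟨(0, 0), by simp⟩⟩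

/-! ### Cells as convex hulls of minimizers -/

/-- The height function `ω` plus the linear form with coefficients `α`, `β`. -/
def tilt (ω : LatticePoint δ → ℝ) (α β : ℝ) (a : LatticePoint δ) : ℝ :=
  α * a.1.1 + β * a.1.2 + ω a

/-- The lattice points at which the tilted height function is minimal. -/
def minimizers (ω : LatticePoint δ → ℝ) (α β : ℝ) : Set (LatticePoint δ) :=
  {a | ∀ b, tilt ω α β a ≤ tilt ω α β b}

lemma minimizers_nonempty (ω : LatticePoint δ → ℝ) (α β : ℝ) :
    (minimizers ω α β).Nonempty :=
  Finite.exists_min (tilt ω α β)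

/-- A convex combination attains the minimum of a linear form only if every generator with nonzero
weight does. This replaces the lifted polytope by finite sets of lattice points from here on. -/
lemma image_fst_lowerFace (ω : LatticePoint δ → ℝ) (α β : ℝ) :
    Prod.fst '' lowerFace ω α β =
      convexHull ℝ (LatticePoint.toPlane '' minimizers ω α β) := by
  have hmin : ∀ a ∈ minimizers ω α β, ∀ w ∈ liftedPolytope ω,
      tilt ω α β a ≤ α * w.1.1 + β * w.1.2 + w.2 := by
    intro a ha w hw
    have hc : Convex ℝ {w : (ℝ × ℝ) × ℝ | tilt ω α β a ≤ α * w.1.1 + β * w.1.2 + w.2} := by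
      intro x hx y hy s t hs ht hst
      simp only [Set.mem_ofPred_eq, Prod.fst_add, Prod.snd_add, Prod.smul_fst, Prod.smul_snd,
        smul_eq_mul] at *
      have : tilt ω α β a = s * tilt ω α β a + t * tilt ω α β a := by rw [← add_mul, hst, one_mul]
      nlinarith [mul_le_mul_of_nonneg_left hx hs, mul_le_mul_of_nonneg_left hy ht]
    refine convexHull_min ?_ hc hw
    rintro _ ⟨b, rfl⟩
    exact ha b
  apply Set.Subset.antisymm
  · rintro _ ⟨z, ⟨hz, hzm⟩, rfl⟩
    obtain ⟨a₀, ha₀⟩ := minimizers_nonempty ω α β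
    have hz' := hz
    rw [liftedPolytope, convexHull_range_eq_exists_affineCombination] at hz'
    obtain ⟨s, w, hw₀, hw₁, hwz⟩ := hz'
    rw [Finset.affineCombination_eq_linear_combination _ _ _ hw₁] at hwz
    have h1 : ∑ a ∈ s, w a * (a.1.1 : ℝ) = z.1.1 := by
      rw [← hwz]; simp [Prod.fst_sum, LatticePoint.toPlane]
    have h2 : ∑ a ∈ s, w a * (a.1.2 : ℝ) = z.1.2 := by
      rw [← hwz]; simp [Prod.fst_sum, Prod.snd_sum, LatticePoint.toPlane]
    have h3 : ∑ a ∈ s, w a * ω a = z.2 := by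
      rw [← hwz]; simp [Prod.snd_sum]
    -- The weighted excess over the minimum has nonnegative terms, so this bound forces each term to
    -- vanish.
    have hsum : ∑ a ∈ s, w a * (tilt ω α β a - tilt ω α β a₀) ≤ 0 := by
      have hle := hzm (a₀.toPlane, ω a₀) (subset_convexHull ℝ _ ⟨a₀, rfl⟩)
      have : ∑ a ∈ s, w a * (tilt ω α β a - tilt ω α β a₀) =
          α * z.1.1 + β * z.1.2 + z.2 - tilt ω α β a₀ := by
        rw [← h1, ← h2, ← h3]
        have h4 : tilt ω α β a₀ = ∑ a ∈ s, w a * tilt ω α β a₀ := by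
          rw [← Finset.sum_mul, hw₁, one_mul]
        rw [h4, Finset.mul_sum, Finset.mul_sum, ← Finset.sum_add_distrib,
          ← Finset.sum_add_distrib, ← Finset.sum_sub_distrib, ← h4]
        refine Finset.sum_congr rfl fun a _ => ?_
        rw [tilt]; ring
      rw [this]
      simp only [LatticePoint.toPlane, tilt] at hle ⊢
      linarith
    have hzero : ∀ a ∈ s, w a ≠ 0 → a ∈ minimizers ω α β := by
      have hnn : ∀ a ∈ s, 0 ≤ w a * (tilt ω α β a - tilt ω α β a₀) := fun a ha =>
        mul_nonneg (hw₀ a ha) (sub_nonneg.2 (ha₀ a))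
      have h0 := (Finset.sum_eq_zero_iff_of_nonneg hnn).1
        (le_antisymm hsum (Finset.sum_nonneg hnn))
      intro a ha hwa b
      have := (mul_eq_zero.1 (h0 a ha)).resolve_left hwa
      linarith [ha₀ b]
    have hz1 : z.1 = ∑ a ∈ s with w a ≠ 0, w a • a.toPlane := by
      rw [Finset.sum_filter_of_ne, ← hwz]
      · simp [Prod.fst_sum]
      · intro a _ h h'
        exact h (by rw [h', zero_smul])
    rw [hz1]
    refine (convex_convexHull ℝ _).sum_mem (fun a ha => hw₀ a (Finset.mem_filter.1 ha).1) ?_ ?_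
    · rw [Finset.sum_filter_ne_zero, hw₁]
    · intro a ha
      rw [Finset.mem_filter] at ha
      exact subset_convexHull ℝ _ ⟨a, hzero a ha.1 ha.2, rfl⟩
  · refine convexHull_min ?_ ?_
    · rintro _ ⟨a, ha, rfl⟩
      exact ⟨(a.toPlane, ω a), ⟨subset_convexHull ℝ _ ⟨a, rfl⟩, hmin a ha⟩, rfl⟩
    · have hc : Convex ℝ (lowerFace ω α β) := by
        intro x hx y hy s t hs ht hst
        refine ⟨convex_convexHull ℝ _ hx.1 hy.1 hs ht hst, fun w hw => ?_⟩
        simp only [Prod.fst_add, Prod.snd_add, Prod.smul_fst, Prod.smul_snd, smul_eq_mul]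
        have h1 := mul_le_mul_of_nonneg_left (hx.2 w hw) hs
        have h2 := mul_le_mul_of_nonneg_left (hy.2 w hw) ht
        obtain rfl : t = 1 - s := by linarith
        linarith
      exact hc.linear_image (LinearMap.fst ℝ (ℝ × ℝ) ℝ)

lemma mem_inducedSubdivision {ω : LatticePoint δ → ℝ} {σ : Set (ℝ × ℝ)} :
    σ ∈ inducedSubdivision ω ↔
      ∃ α β : ℝ, σ = convexHull ℝ (LatticePoint.toPlane '' minimizers ω α β) := by
  simp only [inducedSubdivision, Set.mem_ofPred_eq, image_fst_lowerFace]

/-- Two sets of minimizers whose convex hulls meet in their relative interiors agree. -/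
lemma minimizers_subset_of_weights {ω : LatticePoint δ → ℝ} {α β α' β' : ℝ}
    {S T : Finset (LatticePoint δ)} (hS : (S : Set (LatticePoint δ)) ⊆ minimizers ω α β)
    (hT : (T : Set (LatticePoint δ)) ⊆ minimizers ω α' β')
    {μ ν : LatticePoint δ → ℝ} (hμ : ∀ a ∈ S, 0 ≤ μ a) (hν : ∀ a ∈ T, 0 < ν a)
    (hμ₁ : ∑ a ∈ S, μ a = 1) (hν₁ : ∑ a ∈ T, ν a = 1)
    (h : ∑ a ∈ S, μ a • a.toPlane = ∑ a ∈ T, ν a • a.toPlane) :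
    (T : Set (LatticePoint δ)) ⊆ minimizers ω α β := by
  have hval : ∀ (U : Finset (LatticePoint δ)) (κ : LatticePoint δ → ℝ) (γ γ' : ℝ),
      ∑ a ∈ U, κ a * tilt ω γ γ' a = γ * (∑ a ∈ U, κ a • a.toPlane).1 +
        γ' * (∑ a ∈ U, κ a • a.toPlane).2 + ∑ a ∈ U, κ a * ω a := by
    intro U κ γ γ'
    simp only [Prod.fst_sum, Prod.snd_sum, Prod.smul_fst, Prod.smul_snd, smul_eq_mul,
      LatticePoint.toPlane, Finset.mul_sum, ← Finset.sum_add_distrib]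
    refine Finset.sum_congr rfl fun a _ => ?_
    rw [tilt]; ring
  obtain ⟨a₀, ha₀⟩ := minimizers_nonempty ω α β
  obtain ⟨b₀, hb₀⟩ := minimizers_nonempty ω α' β'
  have hSa : ∑ a ∈ S, μ a * tilt ω α β a = tilt ω α β a₀ := by
    rw [← one_mul (tilt ω α β a₀), ← hμ₁, Finset.sum_mul]
    exact Finset.sum_congr rfl fun a ha => by rw [le_antisymm (hS ha a₀) (ha₀ a)]
  have hTb : ∑ a ∈ T, ν a * tilt ω α' β' a = tilt ω α' β' b₀ := by
    rw [← one_mul (tilt ω α' β' b₀), ← hν₁, Finset.sum_mul]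
    exact Finset.sum_congr rfl fun a ha => by rw [le_antisymm (hT ha b₀) (hb₀ a)]
  -- Both combinations represent the same point, so the linear forms contribute equally. Together
  -- with `hTb` this says that the `ν`-average of `ω` is at most its `μ`-average.
  have hSb : tilt ω α' β' b₀ ≤ ∑ a ∈ S, μ a * tilt ω α' β' a := by
    rw [← one_mul (tilt ω α' β' b₀), ← hμ₁, Finset.sum_mul]
    exact Finset.sum_le_sum fun a ha => mul_le_mul_of_nonneg_left (hb₀ a) (hμ a ha)
  have hTa : ∑ a ∈ T, ν a * (tilt ω α β a - tilt ω α β a₀) ≤ 0 := by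
    simp only [mul_sub, Finset.sum_sub_distrib]
    rw [← Finset.sum_mul, hν₁, one_mul]
    rw [hval] at hSa hTb hSb ⊢
    rw [h] at hSa hSb
    linarith
  have hnn : ∀ a ∈ T, 0 ≤ ν a * (tilt ω α β a - tilt ω α β a₀) := fun a ha =>
    mul_nonneg (hν a ha).le (sub_nonneg.2 (ha₀ a))
  have h0 := (Finset.sum_eq_zero_iff_of_nonneg hnn).1
    (le_antisymm hTa (Finset.sum_nonneg hnn))
  intro a ha b
  have := (mul_eq_zero.1 (h0 a ha)).resolve_left (hν a ha).ne'
  linarith [ha₀ b]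

/-! ### Local convexity and descent on the lattice -/

/-- The three families of local convexity inequalities for a function on the lattice. -/
def LocallyConvex (δ : ℕ) (G : ℤ → ℤ → ℝ) : Prop :=
  ∀ i j : ℤ, 1 ≤ i → 1 ≤ j → i + j ≤ δ →
    G (i - 1) j + G i (j - 1) < G (i - 1) (j - 1) + G i j ∧
    G i (j - 1) + G i j < G (i - 1) j + G (i + 1) (j - 1) ∧
    G (i - 1) j + G i j < G i (j - 1) + G (i - 1) (j + 1)

/-- The reflection fixes the first family and exchanges the other two. -/
lemma LocallyConvex.swap {G : ℤ → ℤ → ℝ} (hG : LocallyConvex δ G) :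
    LocallyConvex δ fun x y => G y x := by
  intro i j hi hj hij
  obtain ⟨h1, h2, h3⟩ := hG j i hj hi (by omega)
  refine ⟨?_, ?_, ?_⟩ <;> dsimp only <;> linarith

/-- This symmetry of the triangle exchanges the corners `(0, 0)` and `(0, δ)`. It exchanges the
first and third families, and turns differences in direction `(1, -1)` into horizontal ones. -/
lemma LocallyConvex.rotate {G : ℤ → ℤ → ℝ} (hG : LocallyConvex δ G) :
    LocallyConvex δ fun x y => G x (δ - x - y) := by
  intro i j hi hj hij
  obtain ⟨h1, h2, h3⟩ := hG i (δ - i - j + 1) hi (by omega) (by omega)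
  refine ⟨?_, ?_, ?_⟩ <;> dsimp only <;> ring_nf at h1 h2 h3 ⊢ <;> linarith

lemma LocallyConvex.add_linear {G : ℤ → ℤ → ℝ} (hG : LocallyConvex δ G) (α β : ℝ) :
    LocallyConvex δ fun x y => α * x + β * y + G x y := by
  intro i j hi hj hij
  obtain ⟨h1, h2, h3⟩ := hG i j hi hj hij
  refine ⟨?_, ?_, ?_⟩ <;> dsimp only <;> push_cast <;> linarith

/-- The first family says that horizontal differences grow under an upward step; the claim
telescopes `n` such steps. -/
lemma LocallyConvex.diff_fst_le {G : ℤ → ℤ → ℝ} (hG : LocallyConvex δ G) {x y : ℤ} (hx : 0 ≤ x)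
    (hy : 0 ≤ y) (n : ℕ) (hn : x + y + n + 1 ≤ δ) :
    G (x + 1) y - G x y ≤ G (x + 1) (y + n) - G x (y + n) ∧
      (n ≠ 0 → G (x + 1) y - G x y < G (x + 1) (y + n) - G x (y + n)) := by
  induction n with
  | zero => simp
  | succ n ih =>
    have ih' := (ih (by push_cast at hn; omega)).1
    obtain ⟨h1, -, -⟩ := hG (x + 1) (y + n + 1) (by omega) (by omega) (by push_cast at hn; omega)
    simp only [add_sub_cancel_right] at h1
    push_cast
    rw [← add_assoc]
    exact ⟨by linarith, fun _ => by linarith⟩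

/-- Likewise, the second family says that horizontal differences grow under a step `(1, -1)`. -/
lemma LocallyConvex.diff_fst_le_diag {G : ℤ → ℤ → ℝ} (hG : LocallyConvex δ G) {x y : ℤ}
    (hx : 0 ≤ x) (hs : x + y + 1 ≤ δ) (n : ℕ) (hn : (n : ℤ) ≤ y) :
    G (x + 1) y - G x y ≤ G (x + n + 1) (y - n) - G (x + n) (y - n) ∧
      (n ≠ 0 → G (x + 1) y - G x y < G (x + n + 1) (y - n) - G (x + n) (y - n)) := by
  induction n with
  | zero => simp
  | succ n ih =>
    have ih' := (ih (by push_cast at hn; omega)).1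
    obtain ⟨-, h2, -⟩ := hG (x + n + 1) (y - n) (by omega) (by push_cast at hn; omega) (by omega)
    simp only [add_sub_cancel_right] at h2
    push_cast
    rw [← add_assoc, ← sub_sub]
    exact ⟨by linarith, fun _ => by linarith⟩

/-- The two conditions `x ≤ x'` and `x + y ≤ x' + y'` describe the cone spanned by the steps `(0,
1)` and `(1, -1)`. Taking the upward steps first keeps the path inside the triangle. -/
lemma LocallyConvex.diff_fst_lt {G : ℤ → ℤ → ℝ} (hG : LocallyConvex δ G) {x y x' y' : ℤ}
    (hx : 0 ≤ x) (hy : 0 ≤ y) (hy' : 0 ≤ y') (hxx : x ≤ x') (hs : x + y ≤ x' + y')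
    (hδ : x' + y' + 1 ≤ δ) (hne : x ≠ x' ∨ y ≠ y') :
    G (x + 1) y - G x y < G (x' + 1) y' - G x' y' := by
  obtain ⟨n, hn⟩ := Int.le.dest hs
  obtain ⟨m, hm⟩ := Int.le.dest hxx
  have h1 := hG.diff_fst_le hx hy n (by omega)
  have h2 := hG.diff_fst_le_diag (x := x) (y := y + n) hx (by omega) m (by omega)
  obtain rfl : x' = x + m := by omega
  obtain rfl : y' = y + n - m := by omega
  by_cases h0 : n = 0
  · have := h2.2 (by omega)
    linarith [h1.1]
  · have := h1.2 h0
    linarith [h2.1]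

lemma LocallyConvex.diff_snd_lt {G : ℤ → ℤ → ℝ} (hG : LocallyConvex δ G) {x y x' y' : ℤ}
    (hx : 0 ≤ x) (hy : 0 ≤ y) (hx' : 0 ≤ x') (hyy : y ≤ y') (hs : x + y ≤ x' + y')
    (hδ : x' + y' + 1 ≤ δ) (hne : x ≠ x' ∨ y ≠ y') :
    G x (y + 1) - G x y < G x' (y' + 1) - G x' y' :=
  hG.swap.diff_fst_lt hy hx hx' hyy (by omega) (by omega) hne.symm

lemma LocallyConvex.diff_diag_lt {G : ℤ → ℤ → ℝ} (hG : LocallyConvex δ G) {x y x' y' : ℤ}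
    (hx : 0 ≤ x) (hy' : 0 ≤ y') (hxx : x ≤ x') (hyy : y' ≤ y) (hs : x + y + 1 ≤ δ)
    (hδ : x' + y' + 1 ≤ δ) (hne : x ≠ x' ∨ y ≠ y') :
    G (x + 1) y - G x (y + 1) < G (x' + 1) y' - G x' (y' + 1) := by
  have h := hG.rotate.diff_fst_lt (x := x) (y := δ - x - y - 1) (x' := x') (y' := δ - x' - y' - 1)
    hx (by omega) (by omega) hxx (by omega) (by omega) (by omega)
  convert h using 3 <;> ring

/-- `G` is constant on the vertices of the unit triangle, so its differences along the three edges
are zero. In each region outside the triangle, the difference along a suitable direction compares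
strictly with one of these zeros, and its sign gives a unit step that decreases `G`. -/
lemma LocallyConvex.exists_lt_up {G : ℤ → ℤ → ℝ} (hG : LocallyConvex δ G) {a b : ℤ}
    (ha : 0 ≤ a) (hb : 0 ≤ b) (hab : a + b + 1 ≤ δ) (h1 : G (a + 1) b = G a b)
    (h2 : G a (b + 1) = G a b) {x y : ℤ} (hx : 0 ≤ x) (hy : 0 ≤ y) (hxy : x + y ≤ δ)
    (hne : ¬ (a ≤ x ∧ b ≤ y ∧ x + y ≤ a + b + 1)) :
    ∃ x' y' : ℤ, 0 ≤ x' ∧ 0 ≤ y' ∧ x' + y' ≤ δ ∧ G x' y' < G x y := by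
  rcases lt_or_ge x a with hxa | hxa
  · rcases le_or_gt (x + y) (a + b) with hs | hs
    · have := hG.diff_fst_lt hx hy hb hxa.le hs hab (by omega)
      exact ⟨x + 1, y, by omega, by omega, by omega, by linarith⟩
    · have := hG.diff_diag_lt (x := x) (y := y - 1) (x' := a) (y' := b) hx hb hxa.le (by omega)
        (by omega) hab (by omega)
      rw [sub_add_cancel] at this
      exact ⟨x + 1, y - 1, by omega, by omega, by omega, by linarith⟩
  rcases lt_or_ge y b with hyb | hyb
  · rcases le_or_gt (x + y) (a + b) with hs | hs
    · have := hG.diff_snd_lt hx hy ha hyb.le hs hab (by omega)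
      exact ⟨x, y + 1, by omega, by omega, by omega, by linarith⟩
    · have := hG.diff_diag_lt (x := a) (y := b) (x' := x - 1) (y' := y) ha hy (by omega) hyb.le
        hab (by omega) (by omega)
      rw [sub_add_cancel] at this
      exact ⟨x - 1, y + 1, by omega, by omega, by omega, by linarith⟩
  rcases eq_or_lt_of_le hxa with rfl | hxa
  · have := hG.diff_snd_lt (x := a) (y := b) (x' := a) (y' := y - 1) ha hb hx (by omega) (by omega)
      (by omega) (by omega)
    rw [sub_add_cancel] at this
    exact ⟨a, y - 1, by omega, by omega, by omega, by linarith⟩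
  · have := hG.diff_fst_lt (x := a) (y := b) (x' := x - 1) (y' := y) ha hb hy (by omega) (by omega)
      (by omega) (by omega)
    rw [sub_add_cancel] at this
    exact ⟨x - 1, y, by omega, by omega, by omega, by linarith⟩

lemma LocallyConvex.exists_lt_down {G : ℤ → ℤ → ℝ} (hG : LocallyConvex δ G) {a b : ℤ}
    (ha : 0 ≤ a) (hb : 0 ≤ b) (hab : a + b + 2 ≤ δ) (h1 : G a (b + 1) = G (a + 1) (b + 1))
    (h2 : G (a + 1) b = G (a + 1) (b + 1)) {x y : ℤ} (hx : 0 ≤ x) (hy : 0 ≤ y)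
    (hxy : x + y ≤ δ) (hne : ¬ (x ≤ a + 1 ∧ y ≤ b + 1 ∧ a + b + 1 ≤ x + y)) :
    ∃ x' y' : ℤ, 0 ≤ x' ∧ 0 ≤ y' ∧ x' + y' ≤ δ ∧ G x' y' < G x y := by
  rcases le_or_gt x a with hxa | hxa
  · rcases le_or_gt (x + y) (a + b + 1) with hs | hs
    · have := hG.diff_fst_lt (x := x) (y := y) (x' := a) (y' := b + 1) hx hy (by omega) hxa
        (by omega) (by omega) (by omega)
      exact ⟨x + 1, y, by omega, by omega, by omega, by linarith⟩
    · have := hG.diff_diag_lt (x := x) (y := y - 1) (x' := a) (y' := b) hx hb hxa (by omega)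
        (by omega) (by omega) (by omega)
      rw [sub_add_cancel] at this
      exact ⟨x + 1, y - 1, by omega, by omega, by omega, by linarith⟩
  rcases le_or_gt y b with hyb | hyb
  · rcases le_or_gt (x + y) (a + b + 1) with hs | hs
    · have := hG.diff_snd_lt (x := x) (y := y) (x' := a + 1) (y' := b) hx hy (by omega) hyb
        (by omega) (by omega) (by omega)
      exact ⟨x, y + 1, by omega, by omega, by omega, by linarith⟩
    · have := hG.diff_diag_lt (x := a) (y := b) (x' := x - 1) (y' := y) ha hy (by omega) hyb
        (by omega) (by omega) (by omega)
      rw [sub_add_cancel] at this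
      exact ⟨x - 1, y + 1, by omega, by omega, by omega, by linarith⟩
  rcases eq_or_lt_of_le (show a + 1 ≤ x from hxa) with rfl | hxa
  · have := hG.diff_snd_lt (x := a + 1) (y := b) (x' := a + 1) (y' := y - 1) (by omega) hb hx
      (by omega) (by omega) (by omega) (by omega)
    rw [sub_add_cancel] at this
    exact ⟨a + 1, y - 1, by omega, by omega, by omega, by linarith⟩
  · have := hG.diff_fst_lt (x := a) (y := b + 1) (x' := x - 1) (y' := y) ha (by omega) hy
      (by omega) (by omega) (by omega) (by omega)
    rw [sub_add_cancel] at this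
    exact ⟨x - 1, y, by omega, by omega, by omega, by linarith⟩

/-! ### Unit triangles as sets of minimizers -/

/-- A height function on the lattice points of `δ Δ₂`, extended by zero. -/
noncomputable def extend (ω : LatticePoint δ → ℝ) (x y : ℤ) : ℝ :=
  if h : 0 ≤ x ∧ 0 ≤ y ∧ x + y ≤ δ then ω ⟨(x, y), h⟩ else 0

lemma extend_of_mem (ω : LatticePoint δ → ℝ) {x y : ℤ} (h : 0 ≤ x ∧ 0 ≤ y ∧ x + y ≤ δ) :
    extend ω x y = ω ⟨(x, y), h⟩ := dif_pos h

lemma locallyConvex_extend {ω : LatticePoint δ → ℝ} (hω : ∀ e : Label δ, 0 < e.form ω) :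
    LocallyConvex δ (extend ω) := by
  intro i j hi hj hij
  have h1 := hω (.first i j hi hj hij)
  have h2 := hω (.second i j hi hj hij)
  have h3 := hω (.third i j hi hj hij)
  simp only [Label.form, Label.large, Label.small] at h1 h2 h3
  rw [extend_of_mem ω (x := i) (y := j) (by omega),
    extend_of_mem ω (x := i - 1) (y := j) (by omega),
    extend_of_mem ω (x := i) (y := j - 1) (by omega),
    extend_of_mem ω (x := i - 1) (y := j - 1) (by omega),
    extend_of_mem ω (x := i + 1) (y := j - 1) (by omega),
    extend_of_mem ω (x := i - 1) (y := j + 1) (by omega)]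
  exact ⟨by linarith, by linarith, by linarith⟩

/-- The set `V` is the set of minimizers of `ω` plus a linear form. -/
def Exposed (ω : LatticePoint δ → ℝ) (V : Set (LatticePoint δ)) : Prop :=
  ∃ α β : ℝ, minimizers ω α β = V

/-- A minimum exists by finiteness and cannot lie outside `V`. Hence a single descending step from
each outside point suffices, wherever that step lands. -/
lemma minimizers_eq_of_exists_lt {ω : LatticePoint δ → ℝ} {α β c : ℝ} {V : Set (LatticePoint δ)}
    (hV : ∀ a ∈ V, tilt ω α β a = c) (h : ∀ a ∉ V, ∃ b, tilt ω α β b < tilt ω α β a) :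
    minimizers ω α β = V := by
  have hsub : minimizers ω α β ⊆ V := by
    intro a ha
    by_contra haV
    obtain ⟨b, hb⟩ := h a haV
    exact absurd (ha b) (not_le.2 hb)
  refine hsub.antisymm fun a ha b => ?_
  obtain ⟨a₀, ha₀⟩ := minimizers_nonempty ω α β
  rw [hV a ha, ← hV a₀ (hsub ha₀)]
  exact ha₀ b

lemma tilt_eq_extend (ω : LatticePoint δ → ℝ) (α β : ℝ) (a : LatticePoint δ) :
    tilt ω α β a = α * a.1.1 + β * a.1.2 + extend ω a.1.1 a.1.2 := by
  rw [extend_of_mem ω a.2, tilt]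

lemma exposed_up {ω : LatticePoint δ → ℝ} (hω : ∀ e : Label δ, 0 < e.form ω) {a b : ℤ}
    (ha : 0 ≤ a) (hb : 0 ≤ b) (hab : a + b + 1 ≤ δ) :
    Exposed ω {p | a ≤ p.1.1 ∧ b ≤ p.1.2 ∧ p.1.1 + p.1.2 ≤ a + b + 1} := by
  let G := extend ω
  -- These slopes make the tilted heights of the three vertices equal.
  let α := G a b - G (a + 1) b
  let β := G a b - G a (b + 1)
  have hG := (locallyConvex_extend hω).add_linear α β
  refine ⟨α, β, minimizers_eq_of_exists_lt (c := α * a + β * b + G a b) ?_ ?_⟩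
  · rintro ⟨⟨x, y⟩, hp⟩ ⟨h1, h2, h3⟩
    dsimp only at h1 h2 h3
    rw [tilt_eq_extend]
    obtain ⟨rfl, rfl⟩ | ⟨rfl, rfl⟩ | ⟨rfl, rfl⟩ :
      x = a ∧ y = b ∨ x = a + 1 ∧ y = b ∨ x = a ∧ y = b + 1 := by omega
    · rfl
    · push_cast
      change α * (a + 1) + β * y + G (a + 1) y = _
      simp only [α]; ring
    · push_cast
      change α * x + β * (b + 1) + G x (b + 1) = _
      simp only [β]; ring
  · rintro ⟨⟨x, y⟩, hx, hy, hxy⟩ hp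
    obtain ⟨x', y', hx', hy', hxy', hlt⟩ := hG.exists_lt_up ha hb hab
      (by push_cast; simp only [α, G]; ring) (by push_cast; simp only [β, G]; ring) hx hy hxy hp
    refine ⟨⟨(x', y'), hx', hy', hxy'⟩, ?_⟩
    rw [tilt_eq_extend, tilt_eq_extend]
    exact hlt

lemma exposed_down {ω : LatticePoint δ → ℝ} (hω : ∀ e : Label δ, 0 < e.form ω) {a b : ℤ}
    (ha : 0 ≤ a) (hb : 0 ≤ b) (hab : a + b + 2 ≤ δ) :
    Exposed ω {p | p.1.1 ≤ a + 1 ∧ p.1.2 ≤ b + 1 ∧ a + b + 1 ≤ p.1.1 + p.1.2} := by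
  let G := extend ω
  let α := G a (b + 1) - G (a + 1) (b + 1)
  let β := G (a + 1) b - G (a + 1) (b + 1)
  have hG := (locallyConvex_extend hω).add_linear α β
  refine ⟨α, β, minimizers_eq_of_exists_lt
    (c := α * (a + 1) + β * (b + 1) + G (a + 1) (b + 1)) ?_ ?_⟩
  · rintro ⟨⟨x, y⟩, hp⟩ ⟨h1, h2, h3⟩
    dsimp only at h1 h2 h3
    rw [tilt_eq_extend]
    obtain ⟨rfl, rfl⟩ | ⟨rfl, rfl⟩ | ⟨rfl, rfl⟩ :
      x = a + 1 ∧ y = b + 1 ∨ x = a + 1 ∧ y = b ∨ x = a ∧ y = b + 1 := by omega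
    · push_cast; rfl
    · push_cast
      change α * (a + 1) + β * y + G (a + 1) y = _
      simp only [β]; ring
    · push_cast
      change α * x + β * (b + 1) + G x (b + 1) = _
      simp only [α]; ring
  · rintro ⟨⟨x, y⟩, hx, hy, hxy⟩ hp
    obtain ⟨x', y', hx', hy', hxy', hlt⟩ := hG.exists_lt_down ha hb hab
      (by push_cast; simp only [α, G]; ring) (by push_cast; simp only [β, G]; ring) hx hy hxy hp
    refine ⟨⟨(x', y'), hx', hy', hxy'⟩, ?_⟩
    rw [tilt_eq_extend, tilt_eq_extend]
    exact hlt

/-- A face of an exposed set is exposed. -/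
lemma Exposed.face {ω : LatticePoint δ → ℝ} {V : Set (LatticePoint δ)} (hV : Exposed ω V)
    {u v c : ℝ} (h : ∀ a ∈ V, 0 ≤ u * a.1.1 + v * a.1.2 + c)
    (hne : ∃ a ∈ V, u * a.1.1 + v * a.1.2 + c = 0) :
    Exposed ω {a ∈ V | u * a.1.1 + v * a.1.2 + c = 0} := by
  obtain ⟨α, β, rfl⟩ := hV
  obtain ⟨a₀, ha₀, hc₀⟩ := hne
  -- The tilt is perturbed by `ε` times the supporting form: for small `ε` the finitely many
  -- positive gaps outside the minimizers persist, while inside them the form breaks the tie in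
  -- favour of the face.
  have hev : ∀ a ∉ minimizers ω α β, ∀ᶠ ε : ℝ in nhdsWithin 0 (Set.Ioi 0),
      tilt ω α β a₀ < tilt ω α β a + ε * (u * a.1.1 + v * a.1.2 + c) := by
    intro a ha
    have hlt : tilt ω α β a₀ < tilt ω α β a := by
      refine lt_of_not_ge fun hle => ha fun b => hle.trans (ha₀ b)
    have hcont : Continuous fun ε : ℝ => tilt ω α β a + ε * (u * a.1.1 + v * a.1.2 + c) := by
      fun_prop
    have := hcont.tendsto 0
    simp only [zero_mul, add_zero] at this
    exact (this.mono_left nhdsWithin_le_nhds).eventually_const_lt hlt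
  have hall := Filter.eventually_all.2 fun a => Filter.eventually_imp_distrib_left.2 (hev a)
  obtain ⟨ε, hε, hε₀⟩ := (hall.and self_mem_nhdsWithin).exists
  have hε₀ : 0 < ε := hε₀
  have htilt : ∀ a, tilt ω (α + ε * u) (β + ε * v) a =
      tilt ω α β a + ε * (u * a.1.1 + v * a.1.2 + c) - ε * c := by
    intro a; simp only [tilt]; ring
  refine ⟨α + ε * u, β + ε * v,
    minimizers_eq_of_exists_lt (c := tilt ω α β a₀ - ε * c) ?_ fun a ha => ⟨a₀, ?_⟩⟩
  · rintro a ⟨ha, hc⟩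
    rw [htilt, hc, le_antisymm (ha a₀) (ha₀ a)]
    ring
  · rw [htilt, htilt, hc₀]
    by_cases haV : a ∈ minimizers ω α β
    · have : 0 < u * a.1.1 + v * a.1.2 + c :=
        (h a haV).lt_of_ne fun h0 => ha ⟨haV, h0.symm⟩
      have := mul_pos hε₀ this
      linarith [ha₀ a]
    · have := hε a haV
      linarith

/-! ### Explicit cells of the honeycomb triangulation -/

/-- The smallest closed cell containing `z` of the arrangement of the lines `x = ℓ`, `y = ℓ`,
`x + y = ℓ` with `ℓ` an integer. -/
def cell (z : ℝ × ℝ) : Set (ℝ × ℝ) :=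
  {w | ((⌊z.1⌋ : ℝ) ≤ w.1 ∧ w.1 ≤ ⌈z.1⌉) ∧ ((⌊z.2⌋ : ℝ) ≤ w.2 ∧ w.2 ≤ ⌈z.2⌉) ∧
    ((⌊z.1 + z.2⌋ : ℝ) ≤ w.1 + w.2 ∧ w.1 + w.2 ≤ ⌈z.1 + z.2⌉)}

lemma tau_image_alcovedCell (z : ℝ × ℝ) : tau '' alcovedCell z = cell (tau z) := by
  ext w
  constructor
  · rintro ⟨y, ⟨h1, h2, h3⟩, rfl⟩
    simp only [cell, tau, Set.mem_ofPred_eq, sub_add_cancel]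
    exact ⟨h3, h2, h1⟩
  · rintro ⟨h1, h2, h3⟩
    simp only [tau, sub_add_cancel] at h1 h2 h3
    refine ⟨(w.1 + w.2, w.2), ⟨h3, h2, ?_⟩, ?_⟩
    · simpa only [add_sub_cancel_right] using h1
    · simp [tau]

lemma mem_honeycomb {σ : Set (ℝ × ℝ)} : σ ∈ honeycomb δ ↔ ∃ z ∈ triangle δ, σ = cell z := by
  constructor
  · rintro ⟨_, ⟨z, ⟨h1, h2, h3⟩, rfl⟩, rfl⟩
    refine ⟨tau z, ⟨?_, h1, ?_⟩, tau_image_alcovedCell z⟩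
    · simpa [tau] using h2
    · simpa [tau] using h3
  · rintro ⟨z, ⟨h1, h2, h3⟩, rfl⟩
    refine ⟨_, ⟨(z.1 + z.2, z.2), ⟨h2, ?_, h3⟩, rfl⟩, ?_⟩
    · simpa using h1
    · rw [tau_image_alcovedCell]
      simp [tau]

lemma convex_cell (z : ℝ × ℝ) : Convex ℝ (cell z) := by
  rintro x ⟨⟨h1, h2⟩, ⟨h3, h4⟩, h5, h6⟩ y ⟨⟨k1, k2⟩, ⟨k3, k4⟩, k5, k6⟩ s t hs ht hst
  obtain rfl : t = 1 - s := by linarith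
  simp only [cell, Set.mem_ofPred_eq, Prod.fst_add, Prod.snd_add, Prod.smul_fst, Prod.smul_snd,
    smul_eq_mul]
  refine ⟨⟨?_, ?_⟩, ⟨?_, ?_⟩, ?_, ?_⟩ <;> nlinarith

lemma cell_eq {z : ℝ × ℝ} {a a' b b' c c' : ℤ} (ha : ⌊z.1⌋ = a) (ha' : ⌈z.1⌉ = a')
    (hb : ⌊z.2⌋ = b) (hb' : ⌈z.2⌉ = b') (hc : ⌊z.1 + z.2⌋ = c) (hc' : ⌈z.1 + z.2⌉ = c') :
    cell z = {w : ℝ × ℝ | ((a : ℝ) ≤ w.1 ∧ w.1 ≤ (a' : ℝ)) ∧ ((b : ℝ) ≤ w.2 ∧ w.2 ≤ (b' : ℝ)) ∧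
      ((c : ℝ) ≤ w.1 + w.2 ∧ w.1 + w.2 ≤ (c' : ℝ))} := by
  subst ha ha' hb hb' hc hc'
  rfl

lemma floor_ceil_of_lt {x : ℝ} {a : ℤ} (h1 : (a : ℝ) < x) (h2 : x < a + 1) :
    ⌊x⌋ = a ∧ ⌈x⌉ = a + 1 := by
  rw [Int.floor_eq_iff, Int.ceil_eq_iff]
  push_cast
  exact ⟨⟨h1.le, h2⟩, by linarith, h2.le⟩

lemma floor_ceil_of_eq {x : ℝ} {a : ℤ} (h : x = a) : ⌊x⌋ = a ∧ ⌈x⌉ = a := by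
  subst h; simp

lemma cell_vertex (a b : ℤ) : cell ((a : ℝ), (b : ℝ)) = {((a : ℝ), (b : ℝ))} := by
  obtain ⟨h1, h2⟩ := floor_ceil_of_eq (x := (a : ℝ)) rfl
  obtain ⟨h3, h4⟩ := floor_ceil_of_eq (x := (b : ℝ)) rfl
  obtain ⟨h5, h6⟩ := floor_ceil_of_eq (x := (a : ℝ) + b) (a := a + b) (by push_cast; rfl)
  rw [cell_eq h1 h2 h3 h4 h5 h6]
  ext ⟨x, y⟩
  simp only [Set.mem_ofPred_eq, Set.mem_singleton_iff, Prod.mk.injEq]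
  push_cast
  constructor
  · rintro ⟨⟨k1, k2⟩, ⟨k3, k4⟩, -⟩
    exact ⟨le_antisymm k2 k1, le_antisymm k4 k3⟩
  · rintro ⟨rfl, rfl⟩
    simp

lemma mem_segment_of_eq {p q w : ℝ × ℝ} (t : ℝ) (h0 : 0 ≤ t) (h1 : t ≤ 1)
    (hx : w.1 = (1 - t) * p.1 + t * q.1) (hy : w.2 = (1 - t) * p.2 + t * q.2) :
    w ∈ segment ℝ p q :=
  ⟨1 - t, t, by linarith, h0, by ring, by ext <;> simp [hx, hy]⟩

lemma cell_horizontal {z : ℝ × ℝ} {a b : ℤ} (h1 : (a : ℝ) < z.1) (h2 : z.1 < a + 1)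
    (h3 : z.2 = b) : cell z = segment ℝ ((a : ℝ), (b : ℝ)) (((a + 1 : ℤ) : ℝ), (b : ℝ)) := by
  obtain ⟨e1, e2⟩ := floor_ceil_of_lt h1 h2
  obtain ⟨e3, e4⟩ := floor_ceil_of_eq h3
  obtain ⟨e5, e6⟩ := floor_ceil_of_lt (x := z.1 + z.2) (a := a + b) (by push_cast; linarith)
    (by push_cast; linarith)
  refine Set.Subset.antisymm ?_ ((convex_cell z).segment_subset ?_ ?_)
  · rw [cell_eq e1 e2 e3 e4 e5 e6]
    rintro ⟨x, y⟩ ⟨⟨k1, k2⟩, ⟨k3, k4⟩, -⟩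
    push_cast at k1 k2 k3 k4
    refine mem_segment_of_eq (x - a) (by linarith) (by linarith) ?_ ?_ <;>
      (push_cast; linarith)
  · rw [cell_eq e1 e2 e3 e4 e5 e6]
    simp
  · rw [cell_eq e1 e2 e3 e4 e5 e6]
    simp only [Set.mem_ofPred_eq]
    push_cast
    refine ⟨⟨?_, ?_⟩, ⟨?_, ?_⟩, ?_, ?_⟩ <;> linarith

lemma cell_vertical {z : ℝ × ℝ} {a b : ℤ} (h1 : (b : ℝ) < z.2) (h2 : z.2 < b + 1)
    (h3 : z.1 = a) : cell z = segment ℝ ((a : ℝ), (b : ℝ)) ((a : ℝ), ((b + 1 : ℤ) : ℝ)) := by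
  obtain ⟨e1, e2⟩ := floor_ceil_of_lt h1 h2
  obtain ⟨e3, e4⟩ := floor_ceil_of_eq h3
  obtain ⟨e5, e6⟩ := floor_ceil_of_lt (x := z.1 + z.2) (a := a + b) (by push_cast; linarith)
    (by push_cast; linarith)
  refine Set.Subset.antisymm ?_ ((convex_cell z).segment_subset ?_ ?_)
  · rw [cell_eq e3 e4 e1 e2 e5 e6]
    rintro ⟨x, y⟩ ⟨⟨k1, k2⟩, ⟨k3, k4⟩, -⟩
    push_cast at k1 k2 k3 k4
    refine mem_segment_of_eq (y - b) (by linarith) (by linarith) ?_ ?_ <;>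
      (push_cast; linarith)
  · rw [cell_eq e3 e4 e1 e2 e5 e6]
    simp
  · rw [cell_eq e3 e4 e1 e2 e5 e6]
    simp only [Set.mem_ofPred_eq]
    push_cast
    refine ⟨⟨?_, ?_⟩, ⟨?_, ?_⟩, ?_, ?_⟩ <;> linarith

lemma cell_diagonal {z : ℝ × ℝ} {a b : ℤ} (h1 : (a : ℝ) < z.1) (h2 : z.1 < a + 1)
    (h3 : z.1 + z.2 = a + b + 1) :
    cell z = segment ℝ ((a : ℝ), ((b + 1 : ℤ) : ℝ)) (((a + 1 : ℤ) : ℝ), (b : ℝ)) := by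
  obtain ⟨e1, e2⟩ := floor_ceil_of_lt h1 h2
  obtain ⟨e3, e4⟩ := floor_ceil_of_lt (x := z.2) (a := b) (by linarith) (by linarith)
  obtain ⟨e5, e6⟩ := floor_ceil_of_eq (x := z.1 + z.2) (a := a + b + 1) (by push_cast; linarith)
  refine Set.Subset.antisymm ?_ ((convex_cell z).segment_subset ?_ ?_)
  · rw [cell_eq e1 e2 e3 e4 e5 e6]
    rintro ⟨x, y⟩ ⟨⟨k1, k2⟩, ⟨k3, k4⟩, k5, k6⟩
    push_cast at k1 k2 k3 k4 k5 k6
    refine mem_segment_of_eq (x - a) (by linarith) (by linarith) ?_ ?_ <;>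
      (push_cast; linarith)
  · rw [cell_eq e1 e2 e3 e4 e5 e6]
    simp only [Set.mem_ofPred_eq]
    push_cast
    refine ⟨⟨?_, ?_⟩, ⟨?_, ?_⟩, ?_, ?_⟩ <;> linarith
  · rw [cell_eq e1 e2 e3 e4 e5 e6]
    simp only [Set.mem_ofPred_eq]
    push_cast
    refine ⟨⟨?_, ?_⟩, ⟨?_, ?_⟩, ?_, ?_⟩ <;> linarith

lemma mem_convexHull_triple {p q r w : ℝ × ℝ} {s t u : ℝ} (hs : 0 ≤ s) (ht : 0 ≤ t) (hu : 0 ≤ u)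
    (h : s + t + u = 1) (hx : w.1 = s * p.1 + t * q.1 + u * r.1)
    (hy : w.2 = s * p.2 + t * q.2 + u * r.2) : w ∈ convexHull ℝ {p, q, r} := by
  have := (convex_convexHull ℝ {p, q, r}).sum_mem (t := Finset.univ) (w := ![s, t, u])
    (z := ![p, q, r]) (by intro i _; fin_cases i <;> simpa) (by simpa [Fin.sum_univ_three])
    (by intro i _; apply subset_convexHull; fin_cases i <;> simp)
  convert this
  ext <;> simp [Fin.sum_univ_three, hx, hy]

lemma cell_up {z : ℝ × ℝ} {a b : ℤ} (h1 : (a : ℝ) < z.1) (h2 : (b : ℝ) < z.2)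
    (h3 : z.1 + z.2 < a + b + 1) :
    cell z = convexHull ℝ {((a : ℝ), (b : ℝ)), (((a + 1 : ℤ) : ℝ), (b : ℝ)),
      ((a : ℝ), ((b + 1 : ℤ) : ℝ))} := by
  obtain ⟨e1, e2⟩ := floor_ceil_of_lt h1 (by linarith)
  obtain ⟨e3, e4⟩ := floor_ceil_of_lt h2 (by linarith)
  obtain ⟨e5, e6⟩ := floor_ceil_of_lt (x := z.1 + z.2) (a := a + b) (by push_cast; linarith)
    (by push_cast; linarith)
  refine Set.Subset.antisymm ?_ (convexHull_min ?_ (convex_cell z))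
  · rw [cell_eq e1 e2 e3 e4 e5 e6]
    rintro ⟨x, y⟩ ⟨⟨k1, k2⟩, ⟨k3, k4⟩, k5, k6⟩
    push_cast at k1 k2 k3 k4 k5 k6
    refine mem_convexHull_triple (s := 1 - (x - a) - (y - b)) (t := x - a) (u := y - b)
      (by linarith) (by linarith) (by linarith) (by ring) ?_ ?_ <;> (push_cast; ring)
  · rw [cell_eq e1 e2 e3 e4 e5 e6]
    rintro _ (rfl | rfl | rfl) <;> simp only [Set.mem_ofPred_eq] <;> push_cast <;>
      refine ⟨⟨?_, ?_⟩, ⟨?_, ?_⟩, ?_, ?_⟩ <;> linarith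

lemma cell_down {z : ℝ × ℝ} {a b : ℤ} (h1 : z.1 < a + 1) (h2 : z.2 < b + 1)
    (h3 : a + b + 1 < z.1 + z.2) :
    cell z = convexHull ℝ {(((a + 1 : ℤ) : ℝ), ((b + 1 : ℤ) : ℝ)), (((a + 1 : ℤ) : ℝ), (b : ℝ)),
      ((a : ℝ), ((b + 1 : ℤ) : ℝ))} := by
  obtain ⟨e1, e2⟩ := floor_ceil_of_lt (a := a) (by linarith) h1
  obtain ⟨e3, e4⟩ := floor_ceil_of_lt (a := b) (by linarith) h2
  obtain ⟨e5, e6⟩ := floor_ceil_of_lt (x := z.1 + z.2) (a := a + b + 1) (by push_cast; linarith)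
    (by push_cast; linarith)
  refine Set.Subset.antisymm ?_ (convexHull_min ?_ (convex_cell z))
  · rw [cell_eq e1 e2 e3 e4 e5 e6]
    rintro ⟨x, y⟩ ⟨⟨k1, k2⟩, ⟨k3, k4⟩, k5, k6⟩
    push_cast at k1 k2 k3 k4 k5 k6
    refine mem_convexHull_triple (s := (x - a) + (y - b) - 1) (t := b + 1 - y) (u := a + 1 - x)
      (by linarith) (by linarith) (by linarith) (by ring) ?_ ?_ <;> (push_cast; ring)
  · rw [cell_eq e1 e2 e3 e4 e5 e6]
    rintro _ (rfl | rfl | rfl) <;> simp only [Set.mem_ofPred_eq] <;> push_cast <;>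
      refine ⟨⟨?_, ?_⟩, ⟨?_, ?_⟩, ?_, ?_⟩ <;> linarith

/-- The possible positions of a point of `δ Δ₂` relative to the honeycomb triangulation. -/
lemma position_cases {z : ℝ × ℝ} (hz : z ∈ triangle δ) :
    ∃ a b : ℤ, 0 ≤ a ∧ 0 ≤ b ∧
      ((z = ((a : ℝ), (b : ℝ)) ∧ a + b ≤ δ) ∨
      ((a : ℝ) < z.1 ∧ z.1 < a + 1 ∧ z.2 = b ∧ a + b + 1 ≤ δ) ∨
      ((b : ℝ) < z.2 ∧ z.2 < b + 1 ∧ z.1 = a ∧ a + b + 1 ≤ δ) ∨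
      ((a : ℝ) < z.1 ∧ z.1 < a + 1 ∧ z.1 + z.2 = a + b + 1 ∧ a + b + 1 ≤ δ) ∨
      ((a : ℝ) < z.1 ∧ (b : ℝ) < z.2 ∧ z.1 + z.2 < a + b + 1 ∧ a + b + 1 ≤ δ) ∨
      (z.1 < a + 1 ∧ z.2 < b + 1 ∧ a + b + 1 < z.1 + z.2 ∧ a + b + 2 ≤ δ)) := by
  obtain ⟨x, y⟩ := z
  obtain ⟨hx, hy, hxy⟩ := hz
  dsimp only at hx hy hxy ⊢
  have hx0 := Int.floor_nonneg.2 hx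
  have hy0 := Int.floor_nonneg.2 hy
  refine ⟨⌊x⌋, ⌊y⌋, hx0, hy0, ?_⟩
  generalize ha : ⌊x⌋ = a at *
  generalize hb : ⌊y⌋ = b at *
  obtain ⟨ha1, ha2⟩ := Int.floor_eq_iff.1 ha
  obtain ⟨hb1, hb2⟩ := Int.floor_eq_iff.1 hb
  -- Integrality of `δ`: if the point lies strictly beyond one lattice line `x + y = c`, the next
  -- such line still meets the triangle.
  have h1 : ∀ c : ℤ, (c : ℝ) < x + y → c + 1 ≤ δ := by
    intro c hc
    have : (c : ℝ) < (δ : ℤ) := by push_cast; linarith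
    exact_mod_cast this
  rcases ha1.eq_or_lt with rfl | ha1
  · rcases hb1.eq_or_lt with rfl | hb1
    · left
      refine ⟨rfl, ?_⟩
      exact_mod_cast hxy
    · right; right; left
      exact ⟨hb1, hb2, rfl, h1 (a + b) (by push_cast; linarith)⟩
  rcases hb1.eq_or_lt with rfl | hb1
  · right; left
    exact ⟨ha1, ha2, rfl, h1 (a + b) (by push_cast; linarith)⟩
  have hab := h1 (a + b) (by push_cast; linarith)
  rcases lt_trichotomy (x + y) (a + b + 1) with h | h | h
  · right; right; right; right; left
    exact ⟨ha1, hb1, h, hab⟩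
  · right; right; right; left
    exact ⟨ha1, ha2, h, hab⟩
  · right; right; right; right; right
    have := h1 (a + b + 1) (by push_cast; linarith)
    exact ⟨ha2, hb2, h, by omega⟩

/-! ### From unit triangles to all honeycomb cells -/

/-- The coefficients are integers so that the face conditions become linear integer arithmetic. -/
lemma Exposed.lattice_face {ω : LatticePoint δ → ℝ} {V W : Set (LatticePoint δ)}
    (hV : Exposed ω V) (u v c : ℤ) (h : ∀ a ∈ V, 0 ≤ u * a.1.1 + v * a.1.2 + c)
    (hW : ∀ a, a ∈ W ↔ a ∈ V ∧ u * a.1.1 + v * a.1.2 + c = 0) (hne : W.Nonempty) :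
    Exposed ω W := by
  have := hV.face (u := u) (v := v) (c := c) (fun a ha => by exact_mod_cast h a ha) (by
    obtain ⟨a, ha⟩ := hne
    exact ⟨a, ((hW a).1 ha).1, by exact_mod_cast ((hW a).1 ha).2⟩)
  convert this using 1
  ext a
  rw [hW]
  refine and_congr_right fun _ => ?_
  exact_mod_cast Iff.rfl

lemma exposed_horizontal {ω : LatticePoint δ → ℝ} (hω : ∀ e : Label δ, 0 < e.form ω) {a b : ℤ}
    (ha : 0 ≤ a) (hb : 0 ≤ b) (hab : a + b + 1 ≤ δ) :
    Exposed ω {⟨(a, b), by grind⟩, ⟨(a + 1, b), by grind⟩} := by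
  refine (exposed_up hω ha hb hab).lattice_face 0 1 (-b) ?_ ?_ ⟨_, Or.inl rfl⟩
  · rintro ⟨⟨x, y⟩, hp⟩ ⟨h1, h2, h3⟩
    dsimp only at *
    omega
  · rintro ⟨⟨x, y⟩, hp⟩
    simp only [Set.mem_insert_iff, Set.mem_singleton_iff, Subtype.mk.injEq, Prod.mk.injEq,
      Set.mem_ofPred_eq]
    omega

lemma exposed_vertical {ω : LatticePoint δ → ℝ} (hω : ∀ e : Label δ, 0 < e.form ω) {a b : ℤ}
    (ha : 0 ≤ a) (hb : 0 ≤ b) (hab : a + b + 1 ≤ δ) :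
    Exposed ω {⟨(a, b), by grind⟩, ⟨(a, b + 1), by grind⟩} := by
  refine (exposed_up hω ha hb hab).lattice_face 1 0 (-a) ?_ ?_ ⟨_, Or.inl rfl⟩
  · rintro ⟨⟨x, y⟩, hp⟩ ⟨h1, h2, h3⟩
    dsimp only at *
    omega
  · rintro ⟨⟨x, y⟩, hp⟩
    simp only [Set.mem_insert_iff, Set.mem_singleton_iff, Subtype.mk.injEq, Prod.mk.injEq,
      Set.mem_ofPred_eq]
    omega

lemma exposed_diagonal {ω : LatticePoint δ → ℝ} (hω : ∀ e : Label δ, 0 < e.form ω) {a b : ℤ}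
    (ha : 0 ≤ a) (hb : 0 ≤ b) (hab : a + b + 1 ≤ δ) :
    Exposed ω {⟨(a, b + 1), by grind⟩, ⟨(a + 1, b), by grind⟩} := by
  refine (exposed_up hω ha hb hab).lattice_face (-1) (-1) (a + b + 1) ?_ ?_ ⟨_, Or.inl rfl⟩
  · rintro ⟨⟨x, y⟩, hp⟩ ⟨h1, h2, h3⟩
    dsimp only at *
    omega
  · rintro ⟨⟨x, y⟩, hp⟩
    simp only [Set.mem_insert_iff, Set.mem_singleton_iff, Subtype.mk.injEq, Prod.mk.injEq,
      Set.mem_ofPred_eq]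
    omega

/-- Every lattice point is an endpoint of a horizontal or vertical unit edge, unless `δ = 0`, when
it is the only lattice point. -/
lemma exposed_singleton {ω : LatticePoint δ → ℝ} (hω : ∀ e : Label δ, 0 < e.form ω)
    (p : LatticePoint δ) : Exposed ω {p} := by
  obtain ⟨⟨a, b⟩, ha, hb, hab⟩ := p
  dsimp only at ha hb hab
  rcases hab.lt_or_eq with hlt | heq
  · refine (exposed_horizontal hω ha hb (by omega)).lattice_face 1 0 (-a) ?_ ?_ ⟨_, rfl⟩
    · rintro ⟨⟨x, y⟩, hp⟩ h
      simp only [Set.mem_insert_iff, Set.mem_singleton_iff, Subtype.mk.injEq, Prod.mk.injEq] at *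
      omega
    · rintro ⟨⟨x, y⟩, hp⟩
      simp only [Set.mem_insert_iff, Set.mem_singleton_iff, Subtype.mk.injEq, Prod.mk.injEq]
      omega
  rcases ha.lt_or_eq with ha' | rfl
  · refine (exposed_horizontal hω (a := a - 1) (b := b) (by omega) hb (by omega)).lattice_face
      (-1) 0 a ?_ ?_ ⟨_, rfl⟩
    · rintro ⟨⟨x, y⟩, hp⟩ h
      simp only [Set.mem_insert_iff, Set.mem_singleton_iff, Subtype.mk.injEq, Prod.mk.injEq] at *
      omega
    · rintro ⟨⟨x, y⟩, hp⟩
      simp only [Set.mem_insert_iff, Set.mem_singleton_iff, Subtype.mk.injEq, Prod.mk.injEq]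
      omega
  rcases hb.lt_or_eq with hb' | rfl
  · refine (exposed_vertical hω (a := 0) (b := b - 1) le_rfl (by omega) (by omega)).lattice_face
      0 (-1) b ?_ ?_ ⟨_, rfl⟩
    · rintro ⟨⟨x, y⟩, hp⟩ h
      simp only [Set.mem_insert_iff, Set.mem_singleton_iff, Subtype.mk.injEq, Prod.mk.injEq] at *
      omega
    · rintro ⟨⟨x, y⟩, hp⟩
      simp only [Set.mem_insert_iff, Set.mem_singleton_iff, Subtype.mk.injEq, Prod.mk.injEq]
      omega
  · have huniv : ∀ q : LatticePoint δ, q = ⟨(0, 0), ha, hb, hab⟩ := by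
      rintro ⟨⟨x, y⟩, hp⟩
      simp only [Subtype.mk.injEq, Prod.mk.injEq]
      omega
    refine ⟨0, 0, Set.ext fun q => ⟨fun _ => huniv q, fun _ r => ?_⟩⟩
    rw [huniv q, huniv r]

/-- The point `z` is a convex combination of the points in `V` with positive weights. -/
def IsPosCombination (V : Finset (LatticePoint δ)) (z : ℝ × ℝ) : Prop :=
  ∃ ν : LatticePoint δ → ℝ, (∀ a ∈ V, 0 < ν a) ∧ ∑ a ∈ V, ν a = 1 ∧
    ∑ a ∈ V, ν a • a.toPlane = z

lemma isPosCombination_pair {p q : LatticePoint δ} (hpq : p ≠ q) {s t : ℝ} (hs : 0 < s)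
    (ht : 0 < t) (h : s + t = 1) {z : ℝ × ℝ} (hz : s • p.toPlane + t • q.toPlane = z) :
    IsPosCombination {p, q} z := by
  refine ⟨fun a => if a = p then s else t, fun a _ => by dsimp only; split_ifs <;> assumption,
    ?_, ?_⟩
  · rw [Finset.sum_pair hpq]
    simp [hpq.symm, h]
  · rw [Finset.sum_pair hpq]
    simp [hpq.symm, hz]

lemma isPosCombination_triple {p q r : LatticePoint δ} (hpq : p ≠ q) (hpr : p ≠ r) (hqr : q ≠ r)
    {s t u : ℝ} (hs : 0 < s) (ht : 0 < t) (hu : 0 < u) (h : s + t + u = 1) {z : ℝ × ℝ}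
    (hz : s • p.toPlane + t • q.toPlane + u • r.toPlane = z) :
    IsPosCombination {p, q, r} z := by
  refine ⟨fun a => if a = p then s else if a = q then t else u,
    fun a _ => by dsimp only; split_ifs <;> assumption, ?_, ?_⟩
  · rw [Finset.sum_insert (by simp [hpq, hpr]), Finset.sum_pair hqr]
    simp [hpq.symm, hpr.symm, hqr.symm, ← add_assoc, h]
  · rw [Finset.sum_insert (by simp [hpq, hpr]), Finset.sum_pair hqr]
    simp [hpq.symm, hpr.symm, hqr.symm, ← add_assoc, hz]

/-- Every point of `δ Δ₂` lies in the relative interior of the convex hull of an exposed set, which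
is a cell of the honeycomb triangulation. -/
lemma exists_exposed_convexHull_eq_cell {ω : LatticePoint δ → ℝ}
    (hω : ∀ e : Label δ, 0 < e.form ω) {z : ℝ × ℝ} (hz : z ∈ triangle δ) :
    ∃ V : Finset (LatticePoint δ), Exposed ω V ∧
      convexHull ℝ (LatticePoint.toPlane '' (V : Set (LatticePoint δ))) = cell z ∧
      IsPosCombination V z := by
  obtain ⟨a, b, ha, hb, h⟩ := position_cases hz
  rcases h with ⟨rfl, h⟩ | ⟨h1, h2, h3, h⟩ | ⟨h1, h2, h3, h⟩ | ⟨h1, h2, h3, h⟩ | ⟨h1, h2, h3, h⟩ |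
    ⟨h1, h2, h3, h⟩
  · refine ⟨{⟨(a, b), ha, hb, h⟩}, ?_, ?_, fun _ => 1, by simp, by simp, ?_⟩
    · simpa using exposed_singleton hω _
    · simp [cell_vertex, LatticePoint.toPlane]
    · simp [LatticePoint.toPlane]
  · refine ⟨{⟨(a, b), by grind⟩, ⟨(a + 1, b), by grind⟩}, ?_, ?_, ?_⟩
    · simpa using exposed_horizontal hω ha hb h
    · rw [cell_horizontal h1 h2 h3]
      simp [Set.image_pair, convexHull_pair, LatticePoint.toPlane]
    · refine isPosCombination_pair (by simp) (s := 1 - (z.1 - a)) (t := z.1 - a) (by linarith)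
        (by linarith) (by ring) ?_
      ext <;> simp [LatticePoint.toPlane] <;> linarith
  · refine ⟨{⟨(a, b), by grind⟩, ⟨(a, b + 1), by grind⟩}, ?_, ?_, ?_⟩
    · simpa using exposed_vertical hω ha hb h
    · rw [cell_vertical h1 h2 h3]
      simp [Set.image_pair, convexHull_pair, LatticePoint.toPlane]
    · refine isPosCombination_pair (by simp) (s := 1 - (z.2 - b)) (t := z.2 - b) (by linarith)
        (by linarith) (by ring) ?_
      ext <;> simp [LatticePoint.toPlane] <;> linarith
  · refine ⟨{⟨(a, b + 1), by grind⟩, ⟨(a + 1, b), by grind⟩}, ?_, ?_, ?_⟩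
    · simpa using exposed_diagonal hω ha hb h
    · rw [cell_diagonal h1 h2 h3]
      simp [Set.image_pair, convexHull_pair, LatticePoint.toPlane]
    · refine isPosCombination_pair (by simp) (s := 1 - (z.1 - a)) (t := z.1 - a) (by linarith)
        (by linarith) (by ring) ?_
      ext <;> simp [LatticePoint.toPlane] <;> linarith
  · refine ⟨{⟨(a, b), by grind⟩, ⟨(a + 1, b), by grind⟩, ⟨(a, b + 1), by grind⟩}, ?_, ?_, ?_⟩
    · convert exposed_up hω ha hb h using 1
      ext ⟨⟨x, y⟩, hp⟩
      simp only [Finset.coe_insert, Finset.coe_singleton, Set.mem_insert_iff,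
        Set.mem_singleton_iff, Subtype.mk.injEq, Prod.mk.injEq, Set.mem_ofPred_eq]
      omega
    · rw [cell_up h1 h2 h3]
      simp [Set.image_insert_eq, LatticePoint.toPlane]
    · refine isPosCombination_triple (by simp) (by simp) (by simp)
        (s := 1 - (z.1 - a) - (z.2 - b)) (t := z.1 - a) (u := z.2 - b) (by linarith)
        (by linarith) (by linarith) (by ring) ?_
      ext <;> simp [LatticePoint.toPlane] <;> ring
  · refine ⟨{⟨(a + 1, b + 1), by grind⟩, ⟨(a + 1, b), by grind⟩, ⟨(a, b + 1), by grind⟩},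
      ?_, ?_, ?_⟩
    · convert exposed_down hω ha hb h using 1
      ext ⟨⟨x, y⟩, hp⟩
      simp only [Finset.coe_insert, Finset.coe_singleton, Set.mem_insert_iff,
        Set.mem_singleton_iff, Subtype.mk.injEq, Prod.mk.injEq, Set.mem_ofPred_eq]
      omega
    · rw [cell_down h1 h2 h3]
      simp [Set.image_insert_eq, LatticePoint.toPlane]
    · refine isPosCombination_triple (by simp) (by simp) (by simp)
        (s := (z.1 - a) + (z.2 - b) - 1) (t := b + 1 - z.2) (u := a + 1 - z.1) (by linarith)
        (by linarith) (by linarith) (by ring) ?_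
      ext <;> simp [LatticePoint.toPlane] <;> ring

lemma convex_triangle (δ : ℕ) : Convex ℝ (triangle δ) := by
  rintro x ⟨h1, h2, h3⟩ y ⟨k1, k2, k3⟩ s t hs ht hst
  obtain rfl : t = 1 - s := by linarith
  simp only [triangle, Set.mem_ofPred_eq, Prod.fst_add, Prod.snd_add, Prod.smul_fst,
    Prod.smul_snd, smul_eq_mul]
  refine ⟨?_, ?_, ?_⟩ <;> nlinarith

lemma LatticePoint.toPlane_mem_triangle (a : LatticePoint δ) : a.toPlane ∈ triangle δ := by
  obtain ⟨⟨x, y⟩, h1, h2, h3⟩ := a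
  dsimp only at h1 h2 h3
  simp only [triangle, LatticePoint.toPlane, Set.mem_ofPred_eq]
  exact ⟨by exact_mod_cast h1, by exact_mod_cast h2, by exact_mod_cast h3⟩

lemma inducedSubdivision_eq_honeycomb {ω : LatticePoint δ → ℝ}
    (hω : ∀ e : Label δ, 0 < e.form ω) : inducedSubdivision ω = honeycomb δ := by
  classical
  ext σ
  rw [mem_inducedSubdivision, mem_honeycomb]
  constructor
  · rintro ⟨α, β, rfl⟩
    set S : Finset (LatticePoint δ) := (minimizers ω α β).toFinset with hS
    have hSm : (S : Set (LatticePoint δ)) = minimizers ω α β := Set.coe_toFinset _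
    have hne : S.Nonempty := by
      rw [← Finset.coe_nonempty, hSm]
      exact minimizers_nonempty ω α β
    have hcard : (0 : ℝ) < S.card := by exact_mod_cast hne.card_pos
    have hsum : ∑ _a ∈ S, (S.card : ℝ)⁻¹ = 1 := by
      rw [Finset.sum_const, nsmul_eq_mul, mul_inv_cancel₀ hcard.ne']
    have hz : ∑ a ∈ S, (S.card : ℝ)⁻¹ • a.toPlane ∈ triangle δ :=
      (convex_triangle δ).sum_mem (fun _ _ => (inv_pos.2 hcard).le) hsum
        fun a _ => a.toPlane_mem_triangle
    obtain ⟨V, ⟨α', β', hV⟩, hcell, ν, hν, hν₁, hνz⟩ :=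
      exists_exposed_convexHull_eq_cell hω hz
    refine ⟨_, hz, ?_⟩
    rw [← hcell]
    -- The barycentre of the minimizers has positive weights on both `S` and `V`, so each set is
    -- contained in the other.
    have h1 : (V : Set (LatticePoint δ)) ⊆ minimizers ω α β :=
      minimizers_subset_of_weights hSm.subset hV.superset (fun _ _ => (inv_pos.2 hcard).le) hν
        hsum hν₁ hνz.symm
    have h2 : (S : Set (LatticePoint δ)) ⊆ minimizers ω α' β' :=
      minimizers_subset_of_weights hV.superset hSm.subset (fun a ha => (hν a ha).le)
        (fun _ _ => inv_pos.2 hcard) hν₁ hsum hνz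
    rw [hSm, hV] at h2
    rw [h1.antisymm h2]
  · rintro ⟨z, hz, rfl⟩
    obtain ⟨V, ⟨α, β, hV⟩, hcell, -⟩ := exists_exposed_convexHull_eq_cell hω hz
    exact ⟨α, β, by rw [hV, hcell]⟩

/-! ### Necessity of the inequalities -/

/-- The witness is the midpoint of the edge. Its strict position inside the triangle later shows
that the edge is interior. -/
lemma Label.edge_eq_cell (e : Label δ) :
    ∃ z : ℝ × ℝ, 0 < z.1 ∧ 0 < z.2 ∧ z.1 + z.2 < δ ∧ e.edge = cell z := by
  rcases e with ⟨i, j, hi, hj, hij⟩ | ⟨i, j, hi, hj, hij⟩ | ⟨i, j, hi, hj, hij⟩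
  all_goals
    have hi' : (1 : ℝ) ≤ i := by exact_mod_cast hi
    have hj' : (1 : ℝ) ≤ j := by exact_mod_cast hj
    have hij' : (i : ℝ) + j ≤ δ := by exact_mod_cast hij
  · refine ⟨(i - 1 / 2, j - 1 / 2), ?_, ?_, ?_, ?_⟩
    · dsimp only; linarith
    · dsimp only; linarith
    · dsimp only; linarith
    · rw [cell_diagonal (a := i - 1) (b := j - 1) (by push_cast; linarith)
        (by push_cast; linarith) (by push_cast; linarith)]
      simp [Label.edge, Label.small, LatticePoint.toPlane]
  · refine ⟨(i, j - 1 / 2), ?_, ?_, ?_, ?_⟩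
    · dsimp only; linarith
    · dsimp only; linarith
    · dsimp only; linarith
    · rw [cell_vertical (a := i) (b := j - 1) (by push_cast; linarith)
        (by push_cast; linarith) rfl]
      simp [Label.edge, Label.small, LatticePoint.toPlane]
  · refine ⟨(i - 1 / 2, j), ?_, ?_, ?_, ?_⟩
    · dsimp only; linarith
    · dsimp only; linarith
    · dsimp only; linarith
    · rw [cell_horizontal (a := i - 1) (b := j) (by push_cast; linarith)
        (by push_cast; linarith) rfl]
      simp [Label.edge, Label.small, LatticePoint.toPlane]

lemma Label.edge_mem_honeycomb (e : Label δ) : e.edge ∈ honeycomb δ := by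
  obtain ⟨z, h1, h2, h3, h⟩ := e.edge_eq_cell
  exact mem_honeycomb.2 ⟨z, ⟨h1.le, h2.le, h3.le⟩, h⟩

/-- Along the edge one coordinate runs through an interval between consecutive integers and
determines the other one. -/
lemma Label.eq_small_of_mem_edge (e : Label δ) {a : LatticePoint δ} (ha : a.toPlane ∈ e.edge) :
    a = e.small.1 ∨ a = e.small.2 := by
  obtain ⟨⟨x, y⟩, hp⟩ := a
  rcases e with ⟨i, j, hi, hj, hij⟩ | ⟨i, j, hi, hj, hij⟩ | ⟨i, j, hi, hj, hij⟩
  all_goals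
    obtain ⟨s, t, hs, ht, hst, h⟩ := ha
    have h1 := congrArg Prod.fst h
    have h2 := congrArg Prod.snd h
    simp only [Label.small, LatticePoint.toPlane, Prod.fst_add, Prod.snd_add, Prod.smul_fst,
      Prod.smul_snd, smul_eq_mul] at h1 h2
    push_cast at h1 h2
    obtain rfl : s = 1 - t := by linarith
    ring_nf at h1 h2
    simp only [Label.small, Subtype.mk.injEq, Prod.mk.injEq]
  · have k1 : (i : ℝ) - 1 ≤ x := by linarith
    have k2 : (x : ℝ) ≤ i := by linarith
    have k3 : (x : ℝ) + y = i + j - 1 := by linarith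
    norm_cast at k1 k2 k3
    omega
  · have k1 : (j : ℝ) - 1 ≤ y := by linarith
    have k2 : (y : ℝ) ≤ j := by linarith
    have k3 : (x : ℝ) = i := by linarith
    norm_cast at k1 k2 k3
    omega
  · have k1 : (i : ℝ) - 1 ≤ x := by linarith
    have k2 : (x : ℝ) ≤ i := by linarith
    have k3 : (y : ℝ) = j := by linarith
    norm_cast at k1 k2 k3
    omega

lemma Label.small_fst_ne_snd (e : Label δ) : e.small.1 ≠ e.small.2 := by
  rcases e with ⟨i, j, hi, hj, hij⟩ | ⟨i, j, hi, hj, hij⟩ | ⟨i, j, hi, hj, hij⟩ <;>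
    simp [Label.small]

set_option linter.unnecessarySeqFocus false in
lemma Label.large_notMem_small (e : Label δ) :
    (e.large.1 ≠ e.small.1 ∧ e.large.1 ≠ e.small.2) ∧
      (e.large.2 ≠ e.small.1 ∧ e.large.2 ≠ e.small.2) := by
  rcases e with ⟨i, j, hi, hj, hij⟩ | ⟨i, j, hi, hj, hij⟩ | ⟨i, j, hi, hj, hij⟩ <;>
    simp [Label.small, Label.large] <;> omega

/-- The two sides are the diagonals of a parallelogram; their common midpoint makes linear forms
cancel. -/
lemma Label.form_tilt (e : Label δ) (ω : LatticePoint δ → ℝ) (α β : ℝ) :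
    e.form (tilt ω α β) = e.form ω := by
  rcases e with ⟨i, j, hi, hj, hij⟩ | ⟨i, j, hi, hj, hij⟩ | ⟨i, j, hi, hj, hij⟩ <;>
    simp only [Label.form, Label.small, Label.large, tilt] <;> push_cast <;> ring

lemma LatticePoint.toPlane_injective : Function.Injective (LatticePoint.toPlane (δ := δ)) := by
  rintro ⟨⟨x, y⟩, hp⟩ ⟨⟨x', y'⟩, hp'⟩ h
  simpa [LatticePoint.toPlane] using h

lemma Label.form_pos_of_inducedSubdivision_eq {ω : LatticePoint δ → ℝ}
    (hω : inducedSubdivision ω = honeycomb δ) (e : Label δ) : 0 < e.form ω := by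
  have he := e.edge_mem_honeycomb
  rw [← hω, mem_inducedSubdivision] at he
  obtain ⟨α, β, he⟩ := he
  have hsub : ∀ a ∈ minimizers ω α β, a = e.small.1 ∨ a = e.small.2 := fun a ha =>
    e.eq_small_of_mem_edge (by rw [he]; exact subset_convexHull ℝ _ ⟨a, ha, rfl⟩)
  have hne : ∀ a : LatticePoint δ, e.edge ≠ {a.toPlane} := by
    intro a ha
    have h1 : e.small.1.toPlane ∈ e.edge := left_mem_segment ℝ _ _
    have h2 : e.small.2.toPlane ∈ e.edge := right_mem_segment ℝ _ _
    rw [ha] at h1 h2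
    exact e.small_fst_ne_snd (LatticePoint.toPlane_injective (h1.trans h2.symm))
  -- If one endpoint were not a minimizer, the cell would be a single point instead of the edge.
  -- This is stated for `p` and `q` in order to be used in both orders.
  have key : ∀ p q : LatticePoint δ, (∀ a ∈ minimizers ω α β, a = p ∨ a = q) →
      p ∈ minimizers ω α β := by
    intro p q h
    by_contra hp
    have hq : minimizers ω α β = {q} := by
      refine (minimizers_nonempty ω α β).subset_singleton_iff.1 fun a ha => ?_
      rcases h a ha with rfl | rfl
      · exact absurd ha hp
      · rfl
    rw [hq, Set.image_singleton, convexHull_singleton] at he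
    exact hne q he
  have hp := key _ _ hsub
  have hq := key _ _ fun a ha => (hsub a ha).symm
  have hlt : ∀ a, a ≠ e.small.1 ∧ a ≠ e.small.2 →
      tilt ω α β e.small.1 < tilt ω α β a := by
    intro a ha
    refine lt_of_not_ge fun hle => ?_
    rcases hsub a fun b => hle.trans (hp b) with h | h
    exacts [ha.1 h, ha.2 h]
  have h1 := hlt _ e.large_notMem_small.1
  have h2 := hlt _ e.large_notMem_small.2
  have h3 := hq e.small.1
  rw [← e.form_tilt ω α β, Label.form]
  linarith

lemma inducedSubdivision_eq_honeycomb_iff {ω : LatticePoint δ → ℝ} :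
    inducedSubdivision ω = honeycomb δ ↔ ∀ e : Label δ, 0 < e.form ω :=
  ⟨Label.form_pos_of_inducedSubdivision_eq, inducedSubdivision_eq_honeycomb⟩

/-! ### Facets of polyhedral cones -/

section Polyhedral

open Filter Topology

variable {E ι : Type*} [AddCommGroup E] [Module ℝ E] [TopologicalSpace E]

/-- The cone on which finitely many linear forms are nonnegative. -/
def polyhedralCone (φ : ι → E →L[ℝ] ℝ) : Set E := {x | ∀ i, 0 ≤ φ i x}

/-- The part of the cone on which one of the linear forms vanishes. -/
def polyhedralWall (φ : ι → E →L[ℝ] ℝ) (i : ι) : Set E := {x ∈ polyhedralCone φ | φ i x = 0}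

/-- Adding `t • q` with `t > 0` moves any point of the closed cone into the open one; then `t` tends
to `0`. -/
lemma closure_setOf_forall_pos [IsTopologicalAddGroup E] [ContinuousSMul ℝ E]
    {φ : ι → E →L[ℝ] ℝ} {q : E} (hq : ∀ i, 0 < φ i q) :
    closure {x | ∀ i, 0 < φ i x} = polyhedralCone φ := by
  apply Set.Subset.antisymm
  · refine closure_minimal (fun x hx i => (hx i).le) ?_
    simp only [polyhedralCone, Set.ofPred_forall]
    exact isClosed_iInter fun i => isClosed_le continuous_const (φ i).continuous
  · intro x hx
    have hcont : Continuous fun t : ℝ => x + t • q := by fun_prop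
    have ht := (hcont.tendsto 0).mono_left (nhdsWithin_le_nhds (s := Set.Ioi 0))
    simp only [zero_smul, add_zero] at ht
    refine mem_closure_of_tendsto ht ?_
    filter_upwards [self_mem_nhdsWithin] with t (ht : 0 < t) i
    rw [map_add, map_smul, smul_eq_mul]
    exact add_pos_of_nonneg_of_pos (hx i) (mul_pos ht (hq i))

omit [TopologicalSpace E] in
lemma le_vectorSpan {F : Set E} {p : Submodule ℝ E} {q : E}
    (h : ∀ v ∈ p, ∃ ε : ℝ, 0 < ε ∧ q + ε • v ∈ F) : p ≤ vectorSpan ℝ F := by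
  intro v hv
  obtain ⟨ε, hε, h1⟩ := h v hv
  -- The zero direction shows that `q` itself lies in `F`.
  obtain ⟨ε', -, h2⟩ := h 0 p.zero_mem
  rw [smul_zero, add_zero] at h2
  have := vsub_mem_vectorSpan ℝ h1 h2
  rw [vsub_eq_sub, add_sub_cancel_left] at this
  exact ((vectorSpan ℝ F).smul_mem_iff hε.ne').1 this

/-- Inactive constraints survive a small step because there are finitely many of them; active ones
are unchanged along `v`. -/
lemma exists_add_smul_mem [Finite ι] {φ : ι → E →L[ℝ] ℝ} {x v : E} (hx : x ∈ polyhedralCone φ)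
    (h : ∀ i, φ i x ≠ 0 ∨ φ i v = 0) : ∃ ε : ℝ, 0 < ε ∧ x + ε • v ∈ polyhedralCone φ := by
  have hev : ∀ i, ∀ᶠ ε : ℝ in 𝓝[>] 0, 0 ≤ φ i (x + ε • v) := by
    intro i
    simp only [map_add, map_smul, smul_eq_mul]
    rcases h i with hi | hi
    · have hcont : Continuous fun ε : ℝ => φ i x + ε * φ i v := by fun_prop
      have ht := (hcont.tendsto 0).mono_left (nhdsWithin_le_nhds (s := Set.Ioi 0))
      simp only [zero_mul, add_zero] at ht
      exact (ht.eventually_const_lt ((hx i).lt_of_ne' hi)).mono fun _ h => h.le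
    · simp only [hi, mul_zero, add_zero]
      exact Eventually.of_forall fun _ => hx i
  obtain ⟨ε, hε, hpos⟩ := ((eventually_all.2 hev).and self_mem_nhdsWithin).exists
  exact ⟨ε, hpos, hε⟩

lemma vectorSpan_polyhedralCone [Finite ι] {φ : ι → E →L[ℝ] ℝ} {q : E} (hq : ∀ i, 0 < φ i q) :
    vectorSpan ℝ (polyhedralCone φ) = ⊤ :=
  top_le_iff.1 <| le_vectorSpan (q := q) fun _ _ =>
    exists_add_smul_mem (fun i => (hq i).le) fun i => Or.inl (hq i).ne'

lemma vectorSpan_polyhedralWall_le {φ : ι → E →L[ℝ] ℝ} {i : ι} {F : Set E}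
    (hF : ∀ x ∈ F, φ i x = 0) : vectorSpan ℝ F ≤ (φ i).toLinearMap.ker := by
  refine Submodule.span_le.2 ?_
  rintro _ ⟨x, hx, y, hy, rfl⟩
  simp [hF x hx, hF y hy]

/-- At `w` only the constraint `i` is active, so a small step in any direction of its kernel stays
in the wall. -/
lemma vectorSpan_polyhedralWall [Finite ι] {φ : ι → E →L[ℝ] ℝ} {i : ι} {w : E}
    (hw : φ i w = 0) (hw' : ∀ j, j ≠ i → 0 < φ j w) :
    vectorSpan ℝ (polyhedralWall φ i) = (φ i).toLinearMap.ker := by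
  refine (vectorSpan_polyhedralWall_le fun x hx => hx.2).antisymm (le_vectorSpan (q := w) ?_)
  intro v hv
  have hv : φ i v = 0 := hv
  have hmem : w ∈ polyhedralCone φ := by
    intro j
    by_cases hj : j = i
    · rw [hj, hw]
    · exact (hw' j hj).le
  obtain ⟨ε, hε, h⟩ := exists_add_smul_mem (φ := φ) (x := w) (v := v) hmem fun j => by
    by_cases hj : j = i
    · rw [hj]; exact Or.inr hv
    · exact Or.inl (hw' j hj).ne'
  exact ⟨ε, hε, h, by simp [hw, hv]⟩

lemma finrank_ker_add_one [FiniteDimensional ℝ E] {f : E →L[ℝ] ℝ} {q : E} (hq : f q ≠ 0) :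
    Module.finrank ℝ f.toLinearMap.ker + 1 = Module.finrank ℝ E :=
  Module.Dual.finrank_ker_add_one_of_ne_zero (f := f.toLinearMap) fun h =>
    hq (by simpa using LinearMap.congr_fun h q)

/-- If none of finitely many linear forms is redundant, they correspond bijectively to the facets
of the cone that they cut out. -/
theorem bijOn_polyhedralWall_facets [FiniteDimensional ℝ E] [Finite ι] {φ : ι → E →L[ℝ] ℝ} {q : E}
    (hq : ∀ i, 0 < φ i q) {w : ι → E} (hw : ∀ i, φ i (w i) = 0)
    (hw' : ∀ i j, j ≠ i → 0 < φ j (w i)) :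
    Set.BijOn (polyhedralWall φ) Set.univ {F | IsFacet (polyhedralCone φ) F} := by
  have hwmem : ∀ i, w i ∈ polyhedralWall φ i := by
    refine fun i => ⟨fun j => ?_, hw i⟩
    by_cases hj : j = i
    · rw [hj, hw]
    · exact (hw' i j hj).le
  have hzero : (0 : E) ∈ polyhedralCone φ := fun i => by simp
  -- Exposed faces are sets of maximizers, hence the sign in `-φ i`.
  refine ⟨fun i _ => ⟨⟨w i, hwmem i⟩, fun _ => ⟨-φ i, ?_⟩, ?_⟩, fun i _ j _ hij => ?_, ?_⟩
  · ext x
    refine and_congr_right fun hx => ⟨fun h y hy => ?_, fun h => ?_⟩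
    · simpa [h] using hy i
    · have := h 0 hzero
      simp only [map_zero, neg_apply, Left.nonneg_neg_iff] at this
      exact this.antisymm (hx i)
  · rw [vectorSpan_polyhedralWall (hw i) (hw' i), vectorSpan_polyhedralCone hq, finrank_top,
      finrank_ker_add_one (hq i).ne']
  · by_contra hne
    have : w i ∈ polyhedralWall φ j := by
      rw [← show polyhedralWall φ i = polyhedralWall φ j from hij]
      exact hwmem i
    exact (hw' i j (Ne.symm hne)).ne' this.2
  · rintro F ⟨hne, hexp, hdim⟩
    obtain ⟨l, hl⟩ := hexp hne
    rw [vectorSpan_polyhedralCone hq, finrank_top] at hdim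
    have hsub : F ⊆ polyhedralCone φ := by
      rw [hl]
      exact fun x hx => hx.1
    -- The maximum of `l` on a cone can only be zero: a maximizer `x` is compared with `0` and with
    -- `2 • x`.
    have hl0 : ∀ x ∈ F, l x = 0 := by
      intro x hx
      rw [hl] at hx
      have h1 := hx.2 0 hzero
      have h2 := hx.2 ((2 : ℝ) • x) fun i => by
        simpa using hx.1 i
      rw [map_zero] at h1
      rw [map_smul, smul_eq_mul] at h2
      linarith
    have hle : ∀ x ∈ polyhedralCone φ, l x ≤ 0 := by
      obtain ⟨x₀, hx₀⟩ := hne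
      intro x hx
      rw [← hl0 x₀ hx₀]
      rw [hl] at hx₀
      exact hx₀.2 x hx
    have hmem : ∀ x ∈ polyhedralCone φ, l x = 0 → x ∈ F := by
      intro x hx h0
      rw [hl]
      exact ⟨hx, fun y hy => h0 ▸ hle y hy⟩
    -- Otherwise, adding up points of `F` on which the respective `φ i` is positive gives a point
    -- where all constraints are slack and `l` vanishes. Then `l ≤ 0` in every direction, so `l = 0`
    -- and `F` is the whole cone, which has the wrong dimension.
    have hex : ∃ i, ∀ x ∈ F, φ i x = 0 := by
      by_contra! hcon
      choose x hxF hx using hcon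
      have := Fintype.ofFinite ι
      have hy : ∀ i, 0 < φ i (∑ j, x j) := by
        intro i
        rw [map_sum]
        exact Finset.sum_pos' (fun j _ => hsub (hxF j) i)
          ⟨i, Finset.mem_univ i, (hsub (hxF i) i).lt_of_ne' (hx i)⟩
      have hly : l (∑ j, x j) = 0 := by
        rw [map_sum]
        exact Finset.sum_eq_zero fun j _ => hl0 _ (hxF j)
      have hlv : ∀ v, l v ≤ 0 := by
        intro v
        obtain ⟨ε, hε, h⟩ := exists_add_smul_mem (φ := φ) (x := ∑ j, x j) (v := v)
          (fun i => (hy i).le) fun i => Or.inl (hy i).ne'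
        have := hle _ h
        rw [map_add, hly, map_smul, smul_eq_mul, zero_add] at this
        exact nonpos_of_mul_nonpos_right this hε
      have hF : F = polyhedralCone φ :=
        hsub.antisymm fun v hv => hmem v hv ((hlv v).antisymm (by simpa using hlv (-v)))
      rw [hF, vectorSpan_polyhedralCone hq, finrank_top] at hdim
      omega
    obtain ⟨i, hi⟩ := hex
    -- Equal dimensions make `F` span the whole hyperplane. Hence `l` vanishes on all of the wall,
    -- which is then contained in `F`.
    have hspan : vectorSpan ℝ F = (φ i).toLinearMap.ker :=
      Submodule.eq_of_le_of_finrank_eq (vectorSpan_polyhedralWall_le hi) <| by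
        have := finrank_ker_add_one (hq i).ne'
        omega
    have hker : vectorSpan ℝ F ≤ l.toLinearMap.ker :=
      vectorSpan_polyhedralWall_le (φ := fun _ : ι => l) (i := i) hl0
    refine ⟨i, Set.mem_univ i, Set.Subset.antisymm (fun x hx => ?_) fun x hx => ⟨hsub hx, hi x hx⟩⟩
    refine hmem x hx.1 (hker ?_)
    rw [hspan]
    exact hx.2

end Polyhedral

/-! ### Irredundancy and the facets of the secondary cone -/

/-- The difference of the two sides of an inequality, as a continuous linear form. -/
noncomputable def Label.formCLM (e : Label δ) : (LatticePoint δ → ℝ) →L[ℝ] ℝ :=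
  let π (a : LatticePoint δ) : (LatticePoint δ → ℝ) →L[ℝ] ℝ := ContinuousLinearMap.proj a
  π e.large.1 + π e.large.2 - (π e.small.1 + π e.small.2)

lemma Label.formCLM_apply (e : Label δ) (ω : LatticePoint δ → ℝ) : e.formCLM ω = e.form ω := rfl

instance : Finite (Label δ) := by
  refine Finite.of_injective (fun e : Label δ => e.small) fun e e' h => ?_
  rcases e with ⟨i, j, hi, hj, hij⟩ | ⟨i, j, hi, hj, hij⟩ | ⟨i, j, hi, hj, hij⟩ <;>
  rcases e' with ⟨i', j', hi', hj', hij'⟩ | ⟨i', j', hi', hj', hij'⟩ | ⟨i', j', hi', hj', hij'⟩ <;>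
  simp only [Label.small, Prod.mk.injEq, Subtype.mk.injEq, Label.first.injEq, Label.second.injEq,
    Label.third.injEq, reduceCtorEq] at h ⊢ <;> omega

/-- A quadratic height function on which all forms are equal to one. -/
def quadratic (δ : ℕ) (a : LatticePoint δ) : ℝ :=
  (a.1.1 : ℝ) ^ 2 + a.1.1 * a.1.2 + (a.1.2 : ℝ) ^ 2

lemma Label.form_quadratic (e : Label δ) : e.form (quadratic δ) = 1 := by
  rcases e with ⟨i, j, hi, hj, hij⟩ | ⟨i, j, hi, hj, hij⟩ | ⟨i, j, hi, hj, hij⟩ <;>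
    simp only [Label.form, Label.small, Label.large, quadratic] <;> push_cast <;> ring

/-- A piecewise linear function that is concave along the segment from `(a, b)` to `(a + 1, b)` and
convex along all other edges of the honeycomb triangulation. -/
def fold (a b x y : ℤ) : ℤ :=
  if b ≤ y then max (a - x) 0 + max (x + y - a - b - 1) 0 - (y - b)
  else max (a + b - x - y) 0 + max (x - a - 1) 0

/-- The three families are written with `x = i - 1` and `y = j - 1`. They hold on the whole lattice,
so they can be transported by lattice symmetries that do not preserve the triangle. -/
lemma fold_first (a b x y : ℤ) :
    fold a b (x + 1) y + fold a b x (y + 1) ≤ fold a b x y + fold a b (x + 1) (y + 1) := by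
  unfold fold
  split_ifs <;> omega

lemma fold_second (a b x y : ℤ) :
    fold a b (x + 1) y + fold a b (x + 1) (y + 1) ≤ fold a b x (y + 1) + fold a b (x + 2) y := by
  unfold fold
  split_ifs <;> omega

lemma fold_third (a b x y : ℤ) (h : x ≠ a ∨ y + 1 ≠ b) :
    fold a b x (y + 1) + fold a b (x + 1) (y + 1) ≤ fold a b (x + 1) y + fold a b x (y + 2) := by
  unfold fold
  split_ifs <;> omega

lemma fold_third_self (a b : ℤ) :
    fold a b (a + 1) (b - 1) + fold a b a (b + 1) = fold a b a b + fold a b (a + 1) b - 1 := by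
  unfold fold
  split_ifs <;> omega

/-- A height function on which the form of the given label is `-1` and all others are
nonnegative. -/
def Label.fold : Label δ → LatticePoint δ → ℝ
  -- The maps `(x, y) ↦ (x, -x - y)` and `(x, y) ↦ (y, x)` make diagonal and vertical edges
  -- horizontal; the first two arguments are the left endpoint of the resulting edge.
  | .first i j _ _ _, a => Honeycomb.fold (i - 1) (1 - i - j) a.1.1 (-a.1.1 - a.1.2)
  | .second i j _ _ _, a => Honeycomb.fold (j - 1) i a.1.2 a.1.1
  | .third i j _ _ _, a => Honeycomb.fold (i - 1) j a.1.1 a.1.2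

lemma Label.form_fold_self (e : Label δ) : e.form e.fold = -1 := by
  rcases e with ⟨i, j, hi, hj, hij⟩ | ⟨i, j, hi, hj, hij⟩ | ⟨i, j, hi, hj, hij⟩ <;>
    simp only [Label.form, Label.small, Label.large, Label.fold]
  · have := fold_third_self (i - 1) (1 - i - j)
    ring_nf at this ⊢
    rify at this
    linarith
  · have := fold_third_self (j - 1) i
    ring_nf at this ⊢
    rify at this
    linarith
  · have := fold_third_self (i - 1) j
    ring_nf at this ⊢
    rify at this
    linarith

/-- The coordinate changes in `Label.fold` permute the families. Labels of the same family lead to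
`fold_third`, whose excluded edge is the one of `e`; all other pairs lead to `fold_first` or
`fold_second`. -/
lemma Label.form_fold_nonneg (e e' : Label δ) (h : e' ≠ e) : 0 ≤ e'.form e.fold := by
  rcases e with ⟨i, j, hi, hj, hij⟩ | ⟨i, j, hi, hj, hij⟩ | ⟨i, j, hi, hj, hij⟩ <;>
  rcases e' with ⟨x, y, hx, hy, hxy⟩ | ⟨x, y, hx, hy, hxy⟩ | ⟨x, y, hx, hy, hxy⟩ <;>
    simp only [Label.form, Label.small, Label.large, Label.fold, ne_eq, Label.first.injEq,
      Label.second.injEq, Label.third.injEq, reduceCtorEq, not_false_eq_true] at h ⊢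
  · have := fold_third (i - 1) (1 - i - j) (x - 1) (-x - y) (by omega)
    ring_nf at this ⊢
    rify at this
    linarith
  · have := fold_second (i - 1) (1 - i - j) (x - 1) (-x - y)
    ring_nf at this ⊢
    rify at this
    linarith
  · have := fold_first (i - 1) (1 - i - j) (x - 1) (-x - y)
    ring_nf at this ⊢
    rify at this
    linarith
  · have := fold_first (j - 1) i (y - 1) (x - 1)
    ring_nf at this ⊢
    rify at this
    linarith
  · have := fold_third (j - 1) i (y - 1) (x - 1) (by omega)
    ring_nf at this ⊢
    rify at this
    linarith
  · have := fold_second (j - 1) i (y - 1) (x - 1)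
    ring_nf at this ⊢
    rify at this
    linarith
  · have := fold_first (i - 1) j (x - 1) (y - 1)
    ring_nf at this ⊢
    rify at this
    linarith
  · have := fold_second (i - 1) j (x - 1) (y - 1)
    ring_nf at this ⊢
    rify at this
    linarith
  · have := fold_third (i - 1) j (x - 1) (y - 1) (by omega)
    ring_nf at this ⊢
    rify at this
    linarith

/-- A height function in the relative interior of the wall of the given label. -/
def Label.wallPoint (e : Label δ) : LatticePoint δ → ℝ := quadratic δ + e.fold

lemma Label.formCLM_wallPoint_self (e : Label δ) : e.formCLM e.wallPoint = 0 := by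
  rw [Label.wallPoint, map_add, formCLM_apply, formCLM_apply, form_quadratic, form_fold_self]
  norm_num

lemma Label.formCLM_wallPoint_pos (e e' : Label δ) (h : e' ≠ e) :
    0 < e'.formCLM e.wallPoint := by
  rw [Label.wallPoint, map_add, formCLM_apply, formCLM_apply, form_quadratic]
  linarith [form_fold_nonneg e e' h]

lemma secondaryCone_honeycomb (δ : ℕ) :
    secondaryCone δ (honeycomb δ) = {ω | ∀ e : Label δ, 0 < e.formCLM ω} :=
  Set.ext fun _ => inducedSubdivision_eq_honeycomb_iff

lemma Label.formCLM_quadratic_pos (e : Label δ) : 0 < e.formCLM (quadratic δ) := by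
  rw [formCLM_apply, form_quadratic]
  exact one_pos

lemma closure_secondaryCone_honeycomb (δ : ℕ) :
    closure (secondaryCone δ (honeycomb δ)) = polyhedralCone (Label.formCLM (δ := δ)) := by
  rw [secondaryCone_honeycomb, closure_setOf_forall_pos Label.formCLM_quadratic_pos]

lemma bijOn_wall_facets (δ : ℕ) :
    Set.BijOn (fun e : Label δ => e.wall) Set.univ
      {F | IsFacet (closure (secondaryCone δ (honeycomb δ))) F} := by
  have : (fun e : Label δ => e.wall) = polyhedralWall Label.formCLM := by
    funext e
    rw [Label.wall, closure_secondaryCone_honeycomb]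
    rfl
  rw [this, closure_secondaryCone_honeycomb]
  exact bijOn_polyhedralWall_facets Label.formCLM_quadratic_pos Label.formCLM_wallPoint_self
    Label.formCLM_wallPoint_pos

/-- The point `e.wallPoint` satisfies every inequality except the omitted one, where it gives
equality. -/
lemma omit_ne_secondaryCone (e : Label δ) :
    {ω | ∀ e' : Label δ, e' ≠ e → 0 < e'.form ω} ≠ secondaryCone δ (honeycomb δ) := by
  intro h
  have hmem : e.wallPoint ∈ {ω | ∀ e' : Label δ, e' ≠ e → 0 < e'.form ω} :=
    e.formCLM_wallPoint_pos
  rw [h, secondaryCone_honeycomb] at hmem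
  exact (hmem e).ne' e.formCLM_wallPoint_self

/-! ### Interior edges -/

/-- A surjective linear form is an open map, so it sends an interior point to an interior point of
the half-line containing the image. -/
lemma pos_of_mem_interior_triangle {z : ℝ × ℝ} (hz : z ∈ interior (triangle δ)) :
    0 < z.1 ∧ 0 < z.2 ∧ z.1 + z.2 < δ := by
  have key : ∀ f : ℝ × ℝ →L[ℝ] ℝ, Function.Surjective f → f z ∈ interior (f '' triangle δ) :=
    fun f hf => (f.isOpenMap hf).image_interior_subset _ ⟨z, hz, rfl⟩
  refine ⟨?_, ?_, ?_⟩
  · have h := key (ContinuousLinearMap.fst ℝ ℝ ℝ) Prod.fst_surjective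
    have := interior_mono (t := Set.Ici 0) (by rintro _ ⟨w, hw, rfl⟩; exact hw.1) h
    rwa [interior_Ici] at this
  · have h := key (ContinuousLinearMap.snd ℝ ℝ ℝ) Prod.snd_surjective
    have := interior_mono (t := Set.Ici 0) (by rintro _ ⟨w, hw, rfl⟩; exact hw.2.1) h
    rwa [interior_Ici] at this
  · have h := key (ContinuousLinearMap.fst ℝ ℝ ℝ + ContinuousLinearMap.snd ℝ ℝ ℝ)
      fun x => ⟨(x, 0), by simp⟩
    have := interior_mono (t := Set.Iic (δ : ℝ)) (by rintro _ ⟨w, hw, rfl⟩; exact hw.2.2) h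
    rwa [interior_Iic] at this

lemma mem_interior_triangle {z : ℝ × ℝ} (h1 : 0 < z.1) (h2 : 0 < z.2) (h3 : z.1 + z.2 < δ) :
    z ∈ interior (triangle δ) := by
  have hopen : IsOpen {w : ℝ × ℝ | 0 < w.1 ∧ 0 < w.2 ∧ w.1 + w.2 < δ} :=
    (isOpen_lt continuous_const continuous_fst).inter
      ((isOpen_lt continuous_const continuous_snd).inter
        (isOpen_lt (continuous_fst.add continuous_snd) continuous_const))
  refine interior_maximal ?_ hopen ⟨h1, h2, h3⟩
  rintro w ⟨k1, k2, k3⟩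
  exact ⟨k1.le, k2.le, k3.le⟩

lemma mem_frontier_triangle {z : ℝ × ℝ} (hz : z ∈ triangle δ)
    (h : z.1 = 0 ∨ z.2 = 0 ∨ z.1 + z.2 = δ) : z ∈ frontier (triangle δ) := by
  refine ⟨subset_closure hz, fun hint => ?_⟩
  obtain ⟨h1, h2, h3⟩ := pos_of_mem_interior_triangle hint
  rcases h with h | h | h
  exacts [h1.ne' h, h2.ne' h, h3.ne h]

lemma self_mem_cell (z : ℝ × ℝ) : z ∈ cell z :=
  ⟨⟨Int.floor_le _, Int.le_ceil _⟩, ⟨Int.floor_le _, Int.le_ceil _⟩, Int.floor_le _, Int.le_ceil _⟩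

lemma cell_subset_triangle {z : ℝ × ℝ} (hz : z ∈ triangle δ) : cell z ⊆ triangle δ := by
  rintro w ⟨⟨h1, -⟩, ⟨h2, -⟩, -, h3⟩
  obtain ⟨k1, k2, k3⟩ := hz
  have l1 : (0 : ℝ) ≤ ⌊z.1⌋ := by exact_mod_cast Int.floor_nonneg.2 k1
  have l2 : (0 : ℝ) ≤ ⌊z.2⌋ := by exact_mod_cast Int.floor_nonneg.2 k2
  have l3 : (⌈z.1 + z.2⌉ : ℝ) ≤ δ := by
    have : ⌈z.1 + z.2⌉ ≤ (δ : ℤ) := Int.ceil_le.2 (by exact_mod_cast k3)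
    exact_mod_cast this
  exact ⟨l1.trans h1, l2.trans h2, h3.trans l3⟩

lemma finrank_vectorSpan_segment {E : Type*} [AddCommGroup E] [Module ℝ E] {p q : E}
    (hpq : p ≠ q) : Module.finrank ℝ (vectorSpan ℝ (segment ℝ p q)) = 1 := by
  have : vectorSpan ℝ (segment ℝ p q) = Submodule.span ℝ {q - p} := by
    rw [← convexHull_pair, ← direction_affineSpan, affineSpan_convexHull, direction_affineSpan,
      vectorSpan_eq_span_vsub_set_right ℝ (Set.mem_insert p {q})]
    simp [Set.image_pair]
  rw [this, finrank_span_singleton (sub_ne_zero.2 hpq.symm)]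

/-- Both signs of `ε` are needed: `1` for upward and `-1` for downward unit triangles. -/
lemma finrank_vectorSpan_eq_two {s : Set (ℝ × ℝ)} {p q r : ℝ × ℝ} {ε : ℝ} (hε : ε ≠ 0)
    (hp : p ∈ s) (hq : q ∈ s) (hr : r ∈ s) (hqp : q - p = (ε, 0)) (hrp : r - p = (0, ε)) :
    Module.finrank ℝ (vectorSpan ℝ s) = 2 := by
  have h1 := vsub_mem_vectorSpan ℝ hq hp
  have h2 := vsub_mem_vectorSpan ℝ hr hp
  rw [vsub_eq_sub, hqp] at h1
  rw [vsub_eq_sub, hrp] at h2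
  have : vectorSpan ℝ s = ⊤ := by
    refine top_le_iff.1 fun v _ => ?_
    have := add_mem (Submodule.smul_mem _ (v.1 / ε) h1) (Submodule.smul_mem _ (v.2 / ε) h2)
    convert this using 1
    ext <;> simp [hε]
  rw [this, finrank_top]
  simp

/-- An edge contains no lattice points besides its endpoints, so the segment determines them and
they determine the label. -/
lemma Label.edge_injective : Function.Injective (Label.edge (δ := δ)) := by
  intro e e' h
  have h1 := e.eq_small_of_mem_edge (a := e'.small.1) (h ▸ left_mem_segment ℝ _ _)
  have h2 := e.eq_small_of_mem_edge (a := e'.small.2) (h ▸ right_mem_segment ℝ _ _)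
  rcases e with ⟨i, j, hi, hj, hij⟩ | ⟨i, j, hi, hj, hij⟩ | ⟨i, j, hi, hj, hij⟩ <;>
  rcases e' with ⟨i', j', hi', hj', hij'⟩ | ⟨i', j', hi', hj', hij'⟩ | ⟨i', j', hi', hj', hij'⟩ <;>
  simp only [Label.small, Prod.mk.injEq, Subtype.mk.injEq, Label.first.injEq, Label.second.injEq,
    Label.third.injEq, reduceCtorEq] at h1 h2 ⊢ <;> omega

lemma Label.edge_mem_interiorEdges (e : Label δ) : e.edge ∈ interiorEdges δ := by
  refine ⟨e.edge_mem_honeycomb, finrank_vectorSpan_segment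
    (LatticePoint.toPlane_injective.ne e.small_fst_ne_snd), fun hsub => ?_⟩
  obtain ⟨z, h1, h2, h3, h⟩ := e.edge_eq_cell
  rw [h] at hsub
  exact (hsub (self_mem_cell z)).2 (mem_interior_triangle h1 h2 h3)

/-- Dimension one leaves the three segment positions. In each, either the segment lies on a side of
the triangle, hence in the frontier, or the strict inequality supplies exactly the bound that a
label requires. -/
lemma exists_edge_eq_of_mem_interiorEdges {σ : Set (ℝ × ℝ)} (hσ : σ ∈ interiorEdges δ) :
    ∃ e : Label δ, e.edge = σ := by
  obtain ⟨hσ, hdim, hfr⟩ := hσ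
  obtain ⟨z, hz, rfl⟩ := mem_honeycomb.1 hσ
  have hfr' : ¬ ∀ w ∈ cell z, w.1 = 0 ∨ w.2 = 0 ∨ w.1 + w.2 = δ := fun h =>
    hfr fun w hw => mem_frontier_triangle (cell_subset_triangle hz hw) (h w hw)
  obtain ⟨a, b, ha, hb, h⟩ := position_cases hz
  rcases h with ⟨rfl, h⟩ | ⟨h1, h2, h3, h⟩ | ⟨h1, h2, h3, h⟩ | ⟨h1, h2, h3, h⟩ | ⟨h1, h2, h3, h⟩ |
    ⟨h1, h2, h3, h⟩
  · rw [cell_vertex, vectorSpan_singleton, finrank_bot] at hdim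
    exact absurd hdim zero_ne_one
  · rcases hb.eq_or_lt with rfl | hb
    · refine absurd (fun w hw => ?_) hfr'
      obtain ⟨-, ⟨k1, k2⟩, -⟩ := hw
      replace k1 : 0 ≤ w.2 := by simpa [h3] using k1
      replace k2 : w.2 ≤ 0 := by simpa [h3] using k2
      exact Or.inr (Or.inl (le_antisymm k2 k1))
    · refine ⟨.third (a + 1) b (by omega) (by omega) (by omega), ?_⟩
      rw [cell_horizontal h1 h2 h3]
      simp [Label.edge, Label.small, LatticePoint.toPlane]
  · rcases ha.eq_or_lt with rfl | ha
    · refine absurd (fun w hw => ?_) hfr'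
      obtain ⟨⟨k1, k2⟩, -⟩ := hw
      replace k1 : 0 ≤ w.1 := by simpa [h3] using k1
      replace k2 : w.1 ≤ 0 := by simpa [h3] using k2
      exact Or.inl (le_antisymm k2 k1)
    · refine ⟨.second a (b + 1) (by omega) (by omega) (by omega), ?_⟩
      rw [cell_vertical h1 h2 h3]
      simp [Label.edge, Label.small, LatticePoint.toPlane]
  · rcases h.eq_or_lt with heq | hlt
    · refine absurd (fun w hw => ?_) hfr'
      obtain ⟨-, -, k1, k2⟩ := hw
      have hzδ : z.1 + z.2 = δ := by
        rw [h3]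
        exact_mod_cast heq
      replace k1 : δ ≤ w.1 + w.2 := by simpa [hzδ] using k1
      replace k2 : w.1 + w.2 ≤ δ := by simpa [hzδ] using k2
      exact Or.inr (Or.inr (le_antisymm k2 k1))
    · refine ⟨.first (a + 1) (b + 1) (by omega) (by omega) (by omega), ?_⟩
      rw [cell_diagonal h1 h2 h3]
      simp [Label.edge, Label.small, LatticePoint.toPlane]
  · rw [cell_up h1 h2 h3, finrank_vectorSpan_eq_two one_ne_zero
      (subset_convexHull ℝ _ (Or.inl rfl)) (subset_convexHull ℝ _ (Or.inr (Or.inl rfl)))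
      (subset_convexHull ℝ _ (Or.inr (Or.inr rfl))) (by simp) (by simp)] at hdim
    omega
  · rw [cell_down h1 h2 h3, finrank_vectorSpan_eq_two (neg_ne_zero.2 one_ne_zero)
      (subset_convexHull ℝ _ (Or.inl rfl)) (subset_convexHull ℝ _ (Or.inr (Or.inr rfl)))
      (subset_convexHull ℝ _ (Or.inr (Or.inl rfl))) (by simp) (by simp)] at hdim
    omega

lemma bijOn_edge_interiorEdges (δ : ℕ) :
    Set.BijOn (fun e : Label δ => e.edge) Set.univ (interiorEdges δ) :=
  ⟨fun e _ => e.edge_mem_interiorEdges, Label.edge_injective.injOn, fun _ hσ =>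
    let ⟨e, he⟩ := exists_edge_eq_of_mem_interiorEdges hσ
    ⟨e, Set.mem_univ e, he⟩⟩

lemma forall_form_pos_iff {ω : LatticePoint δ → ℝ} :
    (∀ e : Label δ, 0 < e.form ω) ↔ ∀ (i j : ℤ) (hi : 1 ≤ i) (hj : 1 ≤ j) (hij : i + j ≤ δ),
      0 < (Label.first i j hi hj hij).form ω ∧ 0 < (Label.second i j hi hj hij).form ω ∧
        0 < (Label.third i j hi hj hij).form ω := by
  refine ⟨fun h i j hi hj hij => ⟨h _, h _, h _⟩, fun h e => ?_⟩
  rcases e with ⟨i, j, hi, hj, hij⟩ | ⟨i, j, hi, hj, hij⟩ | ⟨i, j, hi, hj, hij⟩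
  exacts [(h i j hi hj hij).1, (h i j hi hj hij).2.1, (h i j hi hj hij).2.2]

end Honeycomb

theorem proposition3p5 (δ : ℕ) :
    -- characterization of the height functions that induce the honeycomb triangulation
    (∀ ω : Honeycomb.LatticePoint δ → ℝ,
      Honeycomb.inducedSubdivision ω = Honeycomb.honeycomb δ ↔
        ∀ (i j : ℤ) (_hi : 1 ≤ i) (_hj : 1 ≤ j) (_hij : i + j ≤ δ),
          ω ⟨(i - 1, j - 1), by grind⟩ + ω ⟨(i, j), by grind⟩
              > ω ⟨(i - 1, j), by grind⟩ + ω ⟨(i, j - 1), by grind⟩ ∧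
          ω ⟨(i - 1, j), by grind⟩ + ω ⟨(i + 1, j - 1), by grind⟩
              > ω ⟨(i, j - 1), by grind⟩ + ω ⟨(i, j), by grind⟩ ∧
          ω ⟨(i, j - 1), by grind⟩ + ω ⟨(i - 1, j + 1), by grind⟩
              > ω ⟨(i - 1, j), by grind⟩ + ω ⟨(i, j), by grind⟩) ∧
    -- irredundancy: omitting any one of the inequalities gives a different set
    (∀ e : Honeycomb.Label δ,
      {ω | ∀ e' : Honeycomb.Label δ, e' ≠ e → 0 < e'.form ω} ≠
        Honeycomb.secondaryCone δ (Honeycomb.honeycomb δ)) ∧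
    -- the inequalities correspond bijectively to the facets of the closed secondary cone
    Set.BijOn (fun e : Honeycomb.Label δ => e.wall) Set.univ
      {F | Honeycomb.IsFacet
        (closure (Honeycomb.secondaryCone δ (Honeycomb.honeycomb δ))) F} ∧
    -- the inequalities correspond bijectively to the interior edges
    Set.BijOn (fun e : Honeycomb.Label δ => e.edge) Set.univ (Honeycomb.interiorEdges δ) := by
  refine ⟨fun ω => ?_, Honeycomb.omit_ne_secondaryCone, Honeycomb.bijOn_wall_facets δ,
    Honeycomb.bijOn_edge_interiorEdges δ⟩
  rw [Honeycomb.inducedSubdivision_eq_honeycomb_iff, Honeycomb.forall_form_pos_iff]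
  simp only [Honeycomb.Label.form, Honeycomb.Label.large, Honeycomb.Label.small, sub_pos,
    gt_iff_lt]
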